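/- Let $\Omega\subset\mathbb C$ be a bounded domain with $C^{1,\alpha}$ boundary for some $\alpha>0$, and let $\nu>1$. For $k\in\{0,1\}$ and $\mu>0$, let $C^{k,\mathrm{Log}^\mu L}(\Omega)$ be the space of complex-valued functions $f\in C^k(\Omega)$ with $$\|f\|_{C^{k,\mathrm{Log}^\mu L}(\Omega)}:=\sum_{|\gamma|\le k}\ \sup_{w\in\Omega}|D^\gamma f(w)|+\sum_{|\gamma|=k}\ \sup_{\substack{w,\,w+h\in\Omega\\ h\ne 0}}|D^\gamma f(w+h)-D^\gamma f(w)|\,\bigl|\ln|h|\bigr|^{\mu}<\infty ,$$ where $D^\gamma$ are the partial derivatives in the real coordinates $x,y$; write $C^{\mathrm{Log}^\mu L}(\Omega)$ when $k=0$. For $f\in C^{\mathrm{Log}^\nu L}(\Omega)$ put $$Tf(z)=\frac{-1}{2\pi i}\int_\Omega\frac{f(\zeta)}{\zeta-z}\,d\bar\zeta\wedge d\zeta,\qquad z\in\Omega,\qquad d\bar\zeta\wedge d\zeta=2i\,dx\,dy .$$ Then the integral converges absolutely for every $z\in\Omega$, and $T$ is a bounded linear operator from $C^{\mathrm{Log}^\nu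 L}(\Omega)$ into $C^{1,\mathrm{Log}^{\nu-1}L}(\Omega)$: it is linear, and there is a constant $C$ depending only on $\Omega$ and $\nu$ such that, for all $f\in C^{\mathrm{Log}^\nu L}(\Omega)$, $Tf\in C^{1,\mathrm{Log}^{\nu-1}L}(\Omega)$ and $$\|Tf\|_{C^{1,\mathrm{Log}^{\nu-1}L}(\Omega)}\le C\,\|f\|_{C^{\mathrm{Log}^\nu L}(\Omega)} .$$ In particular $u=Tf$ is a classical solution of $\bar\partial u=f\,d\bar z$: $u\in C^1(\overline\Omega)$, that is, $u\in C^1(\Omega)$ and $u$ and its first partial derivatives extend continuously to $\overline\Omega$, and $\partial u/\partial\bar z=f$ at every point of $\Omega$. -/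

import Mathlib

open MeasureTheory
open scoped ENNReal

noncomputable section

namespace LogCont

/-- The partial derivative of `f` with respect to `x`, where `z = x + i y`. -/
def partialX (f : ℂ → ℂ) (z : ℂ) : ℂ := fderiv ℝ f z 1

/-- The partial derivative of `f` with respect to `y`, where `z = x + i y`. -/
def partialY (f : ℂ → ℂ) (z : ℂ) : ℂ := fderiv ℝ f z Complex.I

/-- `D^γ f = ∂_x^{γ₁} ∂_y^{γ₂} f` for a multi-index `γ = (γ₁, γ₂)`. -/
def multiDeriv (γ : ℕ × ℕ) (f : ℂ → ℂ) : ℂ → ℂ := partialX^[γ.1] (partialY^[γ.2] f)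

/-- The Wirtinger derivative `∂f/∂z̄ = (∂_x f + i ∂_y f) / 2`. -/
def dbar (f : ℂ → ℂ) (z : ℂ) : ℂ := (partialX f z + Complex.I * partialY f z) / 2

/-- The `C^{k, Log^ν L}(Ω)` norm, with value `∞` if one of the suprema is infinite.  The second sum
runs over pairs `w, w' = w + h` in `Ω`; pairs with `h = 0` contribute `0`. -/
def logNorm (k : ℕ) (ν : ℝ) (Ω : Set ℂ) (f : ℂ → ℂ) : ℝ≥0∞ :=
  (∑ j ∈ Finset.range (k + 1), ∑ γ ∈ Finset.HasAntidiagonal.antidiagonal j, ⨆ w ∈ Ω, ‖multiDeriv γ f w‖ₑ) +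
  ∑ γ ∈ Finset.HasAntidiagonal.antidiagonal k, ⨆ w ∈ Ω, ⨆ w' ∈ Ω,
    ‖multiDeriv γ f w' - multiDeriv γ f w‖ₑ * ENNReal.ofReal (|Real.log ‖w' - w‖| ^ ν)

/-- Membership of (the restriction to the open set `Ω` of) `f` in `C^{k, Log^ν L}(Ω)`. -/
def MemLog (k : ℕ) (ν : ℝ) (Ω : Set ℂ) (f : ℂ → ℂ) : Prop :=
  ContDiffOn ℝ k f Ω ∧ logNorm k ν Ω f < ∞

/-- `u ∈ C^k(closure Ω)`: `u` is `C^k` on the open set `Ω`, and `u` and all its partial derivatives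
of order at most `k` extend continuously from `Ω` to its closure. -/
def MemCkClosure (k : ℕ) (Ω : Set ℂ) (u : ℂ → ℂ) : Prop :=
  ContDiffOn ℝ k u Ω ∧ ∀ γ : ℕ × ℕ, γ.1 + γ.2 ≤ k →
    ∃ g : ℂ → ℂ, ContinuousOn g (closure Ω) ∧ Set.EqOn g (multiDeriv γ u) Ω

/-- `Ω` has `C^{1,α}` boundary: near each boundary point, in coordinates obtained by a rigid motion,
`Ω` is the region strictly above the graph of a `C^{1,α}` function. -/
def HasC1HolderBoundary (α : ℝ) (Ω : Set ℂ) : Prop :=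
  ∀ p ∈ frontier Ω, ∃ r : ℝ, 0 < r ∧ ∃ a : ℂ, ‖a‖ = 1 ∧ ∃ φ : ℝ → ℝ,
    ContDiff ℝ 1 φ ∧
    (∃ K : ℝ, ∀ s t : ℝ, |deriv φ s - deriv φ t| ≤ K * |s - t| ^ α) ∧
    ∀ z ∈ Metric.ball p r, z ∈ Ω ↔ φ ((a * (z - p)).re) < (a * (z - p)).im

/-- The operator `Tf(z) = -1/(2πi) ∫_Ω f(ζ)/(ζ - z) dζ̄ ∧ dζ`, where `dζ̄ ∧ dζ = 2i dA` and `dA` is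
Lebesgue measure on the plane. -/
def solT (Ω : Set ℂ) (f : ℂ → ℂ) (z : ℂ) : ℂ :=
  -1 / (2 * (Real.pi : ℂ) * Complex.I) * ∫ ζ in Ω, f ζ / (ζ - z) * (2 * Complex.I)

end LogCont

end

open Set Filter Topology Metric

namespace LogCont

/-! ### Radial integrals in the plane -/

/-! Fix `z` in `Ω` and freeze the density there: `Tf(w) = -π⁻¹ ∫_Ω (f ζ - f z)/(ζ - w) + f z ·
T1(w)`. The first term has a complex derivative at `w = z`, namely `-π⁻¹ ∫_Ω (f ζ - f z)/(ζ - z)²`,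
because the modulus `(-log r)^(-ν)` satisfies the Dini condition when `ν > 1`. For the second,
compare `Ω` with a large disc `B`: the Cauchy transform of the disc gives exactly `conj w`, and the
integral over `B \ Ω` is holomorphic in `Ω`, with derivative `beurling`. Hence `∂Tf = -π⁻¹ ∫
regKernel + f · beurling`, while the antiholomorphic part, coming only from `conj`, is `f`; this is
`hasFDerivAt_solT`.

Two moduli of continuity remain. For the singular integral at points at distance `η`, the part
within `2η` is bounded by the Dini integral, of size `(-log η)^(1-ν)`. On the rest, the difference
of the kernels is at most a constant times `(-log η)^(-ν) r⁻²`, and integrating `r⁻²` over the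
annulus produces one factor `-log η`. Both parts thus lose exactly one power of the logarithm
(`norm_integral_regKernel_sub_le`).

The geometry of the boundary enters only through `beurling`, which is Hölder continuous on `Ω`
(`exists_holder_beurling`). Its derivative is an integral of `(ζ - z)⁻³` over `B \ Ω`. Near a
boundary point this set is the region below a `C^{1,β}` graph `γ`; integration along vertical lines
reduces the integral to `∫ dx/(γ(x) - z)²`. Since `∫ γ'(x) dx/(γ(x) - z)² = 0`, the factor `1/γ'(x)`
may be replaced by its difference from the value at the foot of `z`, which is `O(|x - Re z|^β)`. So
the derivative blows up at most like the height above the graph to the power `β - 1`, and a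
Hardy–Littlewood argument followed by compactness yields a global Hölder bound, stronger than any
logarithmic one. -/

lemma setOf_norm_Ico_ae_eq_Ioo (z : ℂ) (a b : ℝ) :
    {ζ : ℂ | ‖ζ - z‖ ∈ Ico a b} =ᵐ[volume] {ζ : ℂ | ‖ζ - z‖ ∈ Ioo a b} := by
  have h : ∀ᵐ ζ : ℂ, ζ ∉ sphere z a := by
    rw [← MeasureTheory.measure_eq_zero_iff_ae_notMem]
    by_cases ha : a = 0
    · subst ha; simp
    · exact Measure.addHaar_sphere_of_ne_zero _ _ ha
  filter_upwards [h] with ζ hζ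
  rw [mem_sphere_iff_norm] at hζ
  refine propext ⟨fun h => ⟨lt_of_le_of_ne h.1 (Ne.symm hζ), h.2⟩, fun h => ⟨h.1.le, h.2⟩⟩

/-- Polar coordinates. Since `k` is nonnegative, a primitive of `r * k r` continuous up to the
endpoints already forces integrability, so the singularity at the centre needs no separate estimate.
The half-open interval makes `a = 0` give a whole disc. -/
lemma radial_integral {k G : ℝ → ℝ} {a b : ℝ} (ha : 0 ≤ a) (hab : a ≤ b)
    (hG : ContinuousOn G (Icc a b)) (hd : ∀ r ∈ Ioo a b, HasDerivAt G (r * k r) r)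
    (hk : ∀ r ∈ Ioo a b, 0 ≤ k r) (z : ℂ) :
    IntegrableOn (fun ζ : ℂ => k ‖ζ - z‖) {ζ : ℂ | ‖ζ - z‖ ∈ Ico a b} ∧
    ∫ ζ in {ζ : ℂ | ‖ζ - z‖ ∈ Ico a b}, k ‖ζ - z‖ = 2 * Real.pi * (G b - G a) := by
  have hpos : ∀ r ∈ Ioo a b, 0 ≤ r * k r := fun r hr =>
    mul_nonneg (ha.trans hr.1.le) (hk r hr)
  have hI : IntegrableOn (fun r => r * k r) (Ioo a b) :=
    (intervalIntegral.integrableOn_deriv_of_nonneg hG hd hpos).mono_set Ioo_subset_Ioc_self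
  have hint : ∫ r in Ioo a b, r * k r = G b - G a := by
    rw [← integral_Ioc_eq_integral_Ioo, ← intervalIntegral.integral_of_le hab]
    refine intervalIntegral.integral_eq_sub_of_hasDerivAt_of_le hab hG hd ?_
    rw [intervalIntegrable_iff_integrableOn_Ioo_of_le hab]; exact hI
  have hms : MeasurableSet {ζ : ℂ | ‖ζ - z‖ ∈ Ioo a b} :=
    (by fun_prop : Measurable fun ζ : ℂ => ‖ζ - z‖) measurableSet_Ioo
  have hsub : Ioo a b ⊆ Ioi 0 := fun r hr => lt_of_le_of_lt ha hr.1
  have hfun : (fun y : ℝ => y ^ (Module.finrank ℝ ℂ - 1) • (Ioo a b).indicator k y)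
      = (Ioo a b).indicator (fun r => r * k r) := by
    ext y
    by_cases hy : y ∈ Ioo a b <;> simp [hy, Complex.finrank_real_complex]
  have hind : {ζ : ℂ | ‖ζ - z‖ ∈ Ioo a b}.indicator (fun ζ : ℂ => k ‖ζ - z‖)
      = fun ζ => (fun x : ℂ => (Ioo a b).indicator k ‖x‖) (ζ - z) := by
    ext ζ
    by_cases hy : ‖ζ - z‖ ∈ Ioo a b
    · rw [indicator_of_mem (by exact hy)]; simp [indicator_of_mem hy]
    · rw [indicator_of_notMem (by exact hy)]; simp [indicator_of_notMem hy]
  constructor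
  · rw [integrableOn_congr_set_ae (setOf_norm_Ico_ae_eq_Ioo z a b),
      ← integrable_indicator_iff hms, hind]
    refine Integrable.comp_sub_right (μ := (volume : Measure ℂ)) (f := fun x : ℂ => (Ioo a b).indicator k ‖x‖) ?_ z
    rw [integrable_fun_norm_addHaar, hfun, IntegrableOn, integrable_indicator_iff measurableSet_Ioo,
      IntegrableOn, Measure.restrict_restrict measurableSet_Ioo,
      inter_eq_self_of_subset_left hsub]
    exact hI
  · rw [setIntegral_congr_set (setOf_norm_Ico_ae_eq_Ioo z a b), ← integral_indicator hms, hind,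
      integral_sub_right_eq_self (fun x : ℂ => (Ioo a b).indicator k ‖x‖) z,
      integral_fun_norm_addHaar volume, hfun, setIntegral_indicator measurableSet_Ioo,
      inter_eq_self_of_subset_right hsub, hint]
    have : (volume : Measure ℂ).real (ball 0 1) = Real.pi := by
      simp [Measure.real, Complex.volume_ball]
    rw [this, Complex.finrank_real_complex]
    simp [mul_assoc]

lemma setOf_norm_Ico_zero (z : ℂ) (b : ℝ) : {ζ : ℂ | ‖ζ - z‖ ∈ Ico 0 b} = ball z b := by
  ext ζ; simp [dist_eq_norm]

/-- The integral of `‖ζ - z‖ ^ (-s)` over a disc, for `s < 2`. -/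
lemma ball_integral_rpow {s : ℝ} (hs : s < 2) {b : ℝ} (hb : 0 ≤ b) (z : ℂ) :
    IntegrableOn (fun ζ : ℂ => ‖ζ - z‖ ^ (-s)) (ball z b) ∧
    ∫ ζ in ball z b, ‖ζ - z‖ ^ (-s) = 2 * Real.pi * (b ^ (2 - s) / (2 - s)) := by
  have h2 : 0 < 2 - s := by linarith
  have := radial_integral (k := fun r => r ^ (-s)) (G := fun r => r ^ (2 - s) / (2 - s))
    le_rfl hb ?_ ?_ ?_ z
  · rw [setOf_norm_Ico_zero] at this
    simpa [Real.zero_rpow h2.ne'] using this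
  · exact ((Real.continuous_rpow_const h2.le).div_const _).continuousOn
  · intro r hr
    have h := (Real.hasDerivAt_rpow_const (x := r) (p := 2 - s) (Or.inl hr.1.ne')).div_const (2 - s)
    refine h.congr_deriv ?_
    rw [show (2 - s - 1 : ℝ) = 1 + -s by ring, Real.rpow_add hr.1, Real.rpow_one]
    field_simp
  · intro r hr; exact Real.rpow_nonneg hr.1.le _

lemma annulus_integral_sq {a b : ℝ} (ha : 0 < a) (hab : a ≤ b) (z : ℂ) :
    IntegrableOn (fun ζ : ℂ => (‖ζ - z‖ ^ 2)⁻¹) {ζ : ℂ | ‖ζ - z‖ ∈ Ico a b} ∧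
    ∫ ζ in {ζ : ℂ | ‖ζ - z‖ ∈ Ico a b}, (‖ζ - z‖ ^ 2)⁻¹
      = 2 * Real.pi * (Real.log b - Real.log a) := by
  refine radial_integral (k := fun r => (r ^ 2)⁻¹) (G := Real.log) ha.le hab ?_ ?_ ?_ z
  · exact Real.continuousOn_log.mono fun r hr => (ha.trans_le hr.1).ne'
  · intro r hr
    have hr0 : r ≠ 0 := (ha.trans hr.1).ne'
    convert Real.hasDerivAt_log hr0 using 1
    field_simp
  · intro r _; positivity

/-- The Dini integral of the modulus `(-log r) ^ (-ν)`. -/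
lemma ball_integral_log {ν : ℝ} (hν : 1 < ν) {b : ℝ} (hb : 0 ≤ b) (hb1 : b < 1) (z : ℂ) :
    IntegrableOn (fun ζ : ℂ => (-Real.log ‖ζ - z‖) ^ (-ν) * (‖ζ - z‖ ^ 2)⁻¹) (ball z b) ∧
    ∫ ζ in ball z b, (-Real.log ‖ζ - z‖) ^ (-ν) * (‖ζ - z‖ ^ 2)⁻¹
      = 2 * Real.pi * ((-Real.log b) ^ (1 - ν) / (ν - 1)) := by
  have hn : 1 - ν ≠ 0 := by linarith
  have hn' : ν - 1 ≠ 0 := by linarith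
  have := radial_integral (k := fun r => (-Real.log r) ^ (-ν) * (r ^ 2)⁻¹)
    (G := fun r => (-Real.log r) ^ (1 - ν) / (ν - 1)) le_rfl hb ?_ ?_ ?_ z
  · rw [setOf_norm_Ico_zero] at this
    simpa [Real.zero_rpow hn] using this
  · refine ContinuousOn.div_const ?_ _
    intro r hr
    rcases eq_or_lt_of_le hr.1 with h0 | h0
    · subst h0
      -- The conventions `log 0 = 0` and `0 ^ (1 - ν) = 0` give the primitive the value `0` at the
      -- origin, which is also its limit there.
      rw [ContinuousWithinAt, Real.log_zero, neg_zero, Real.zero_rpow hn]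
      have h1 : Tendsto (fun r : ℝ => (-Real.log r) ^ (1 - ν)) (𝓝[>] 0) (𝓝 0) := by
        have := tendsto_rpow_neg_atTop (show 0 < ν - 1 by linarith)
        simp only [neg_sub] at this
        exact this.comp (tendsto_neg_atBot_atTop.comp Real.tendsto_log_nhdsGT_zero)
      have h2 : Tendsto (fun r : ℝ => (-Real.log r) ^ (1 - ν)) (𝓝[≥] 0) (𝓝 0) := by
        rw [← Ioi_insert, nhdsWithin_insert, tendsto_sup]
        refine ⟨?_, h1⟩
        rw [tendsto_pure_left]
        intro s hs
        simpa [Real.zero_rpow hn] using mem_of_mem_nhds hs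
      exact h2.mono_left (nhdsWithin_mono _ fun x hx => hx.1)
    · have hl : Real.log r < 0 := Real.log_neg h0 (lt_of_le_of_lt hr.2 hb1)
      refine ContinuousAt.continuousWithinAt ?_
      exact (Real.continuousAt_log h0.ne').neg.rpow_const (Or.inl (neg_ne_zero.2 hl.ne))
  · intro r hr
    have hl : Real.log r < 0 := Real.log_neg hr.1 (hr.2.trans hb1)
    have h := ((Real.hasDerivAt_log hr.1.ne').neg.rpow_const (p := 1 - ν)
      (Or.inl (neg_ne_zero.2 hl.ne))).div_const (ν - 1)
    refine h.congr_deriv ?_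
    have hr0 : r ≠ 0 := hr.1.ne'
    rw [show (1 - ν - 1 : ℝ) = -ν by ring, Pi.neg_apply]
    field_simp
    ring
  · intro r hr
    have hl : Real.log r < 0 := Real.log_neg hr.1 (hr.2.trans hb1)
    have : 0 ≤ -Real.log r := by linarith
    positivity

/-- Integrability of `‖ζ - z‖ ^ (-3)` away from `z`. -/
lemma integral_cube_far {a : ℝ} (ha : 0 < a) (z : ℂ) :
    IntegrableOn (fun ζ : ℂ => (‖ζ - z‖ ^ 3)⁻¹) (ball z a)ᶜ ∧
    ∫ ζ in (ball z a)ᶜ, (‖ζ - z‖ ^ 3)⁻¹ = 2 * Real.pi / a := by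
  have hms : MeasurableSet (ball z a)ᶜ := measurableSet_ball.compl
  have hI0 : IntegrableOn (fun r : ℝ => r ^ (-2 : ℝ)) (Ioi a) :=
    integrableOn_Ioi_rpow_of_lt (by norm_num) ha
  have hfun : (fun y : ℝ => y ^ (Module.finrank ℝ ℂ - 1) • (Ici a).indicator (fun r => (r ^ 3)⁻¹) y)
      = (Ici a).indicator (fun r => r ^ (-2 : ℝ)) := by
    ext y
    by_cases hy : y ∈ Ici a
    · have hy0 : 0 < y := ha.trans_le hy
      rw [indicator_of_mem hy, indicator_of_mem hy, Complex.finrank_real_complex, Real.rpow_neg hy0.le]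
      simp
      field_simp
    · simp [hy]
  have hind : (ball z a)ᶜ.indicator (fun ζ : ℂ => (‖ζ - z‖ ^ 3)⁻¹)
      = fun ζ => (fun x : ℂ => (Ici a).indicator (fun r => (r ^ 3)⁻¹) ‖x‖) (ζ - z) := by
    ext ζ
    by_cases hy : a ≤ ‖ζ - z‖
    · rw [indicator_of_mem (by simpa [dist_eq_norm] using hy)]; simp [hy]
    · rw [indicator_of_notMem (by simpa [dist_eq_norm] using hy)]; simp [hy]
  have hsub : Ici a ⊆ Ioi 0 := fun r hr => lt_of_lt_of_le ha hr
  constructor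
  · rw [← integrable_indicator_iff hms, hind]
    refine Integrable.comp_sub_right (μ := (volume : Measure ℂ))
      (f := fun x : ℂ => (Ici a).indicator (fun r => (r ^ 3)⁻¹) ‖x‖) ?_ z
    rw [integrable_fun_norm_addHaar, hfun, IntegrableOn, integrable_indicator_iff measurableSet_Ici,
      IntegrableOn, Measure.restrict_restrict measurableSet_Ici,
      inter_eq_self_of_subset_left hsub]
    exact (integrableOn_Ici_iff_integrableOn_Ioi (by simp)).2 hI0
  · rw [← integral_indicator hms, hind,
      integral_sub_right_eq_self (fun x : ℂ => (Ici a).indicator (fun r => (r ^ 3)⁻¹) ‖x‖) z,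
      integral_fun_norm_addHaar volume, hfun, setIntegral_indicator measurableSet_Ici,
      inter_eq_self_of_subset_right hsub, integral_Ici_eq_integral_Ioi,
      integral_Ioi_rpow_of_lt (by norm_num) ha]
    have : (volume : Measure ℂ).real (ball 0 1) = Real.pi := by
      simp [Measure.real, Complex.volume_ball]
    rw [this, Complex.finrank_real_complex]
    norm_num [Real.rpow_neg_one]
    ring

/-! ### The Cauchy transform of a disc -/

lemma integrableOn_inv_sub {E : Set ℂ} (hE : Bornology.IsBounded E) (z : ℂ) :
    IntegrableOn (fun ζ : ℂ => (ζ - z)⁻¹) E := by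
  obtain ⟨R, hR⟩ := hE.subset_ball z
  have h := (ball_integral_rpow (s := 1) (by norm_num) (le_max_right R 0) z).1
  have h' : IntegrableOn (fun ζ : ℂ => (ζ - z)⁻¹) (ball z (max R 0)) := by
    refine Integrable.mono' h (Measurable.aestronglyMeasurable (by fun_prop)) ?_
    refine Eventually.of_forall fun ζ => ?_
    rw [norm_inv, Real.rpow_neg_one]
  exact h'.mono_set (hR.trans (ball_subset_ball (le_max_left _ _)))

lemma circleAverage_inv_sub_of_lt {z : ℂ} {r : ℝ} (hr : 0 < r) (h : r < ‖z‖) :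
    Real.circleAverage (fun ζ => (ζ - z)⁻¹) 0 r = -z⁻¹ := by
  have hd : DiffContOnCl ℂ (fun ζ : ℂ => (ζ - z)⁻¹) (ball 0 |r|) := by
    refine DifferentiableOn.diffContOnCl fun ζ hζ => ?_
    refine DifferentiableAt.differentiableWithinAt ?_
    refine DifferentiableAt.inv (by fun_prop) ?_
    intro h0
    have h1 : ‖ζ‖ ≤ r := by
      have := closure_ball_subset_closedBall hζ
      simpa [abs_of_pos hr] using this
    rw [sub_eq_zero] at h0
    rw [h0] at h1
    linarith
  rw [hd.circleAverage]
  simp [inv_neg]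

/-- With the pole inside the circle, the residues of `1/(ζ(ζ - z))` at `0` and `z` cancel; for `z =
0` the integrand is `ζ⁻²`, which has a primitive. -/
lemma circleAverage_inv_sub_of_gt {z : ℂ} {r : ℝ} (h : ‖z‖ < r) :
    Real.circleAverage (fun ζ => (ζ - z)⁻¹) 0 r = 0 := by
  have hr : 0 < r := (norm_nonneg z).trans_lt h
  rw [Real.circleAverage_eq_circleIntegral hr.ne']
  have key : (∮ ζ in C(0, r), (ζ - 0)⁻¹ • (ζ - z)⁻¹) = 0 := by
    by_cases hz : z = 0
    · subst hz
      have := circleIntegral.integral_sub_zpow_of_ne (n := -2) (by norm_num) 0 0 r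
      refine Eq.trans ?_ this
      refine circleIntegral.integral_congr hr.le fun ζ hζ => ?_
      simp [show (-2 : ℤ) = -(2 : ℕ) by norm_num, zpow_neg, sq]
    · have h1 := circleIntegral.integral_sub_inv_of_mem_ball (c := 0) (w := z) (R := r)
        (by simpa using h)
      have h2 := circleIntegral.integral_sub_inv_of_mem_ball (c := 0) (w := 0) (R := r)
        (by simpa using hr)
      have hc1 : CircleIntegrable (fun ζ => (ζ - z)⁻¹) 0 r := by
        rw [circleIntegrable_sub_inv_iff]; right
        simp [abs_of_pos hr, h.ne]
      have hc2 : CircleIntegrable (fun ζ => (ζ - 0)⁻¹) 0 r := by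
        rw [circleIntegrable_sub_inv_iff]; right
        simpa using (abs_pos.2 hr.ne').ne
      have h3 := circleIntegral.integral_sub hc1 hc2
      rw [h1, h2, sub_self] at h3
      have : (∮ ζ in C(0, r), (ζ - 0)⁻¹ • (ζ - z)⁻¹)
          = z⁻¹ • ∮ ζ in C(0, r), ((ζ - z)⁻¹ - (ζ - 0)⁻¹) := by
        rw [← circleIntegral.integral_smul]
        refine circleIntegral.integral_congr hr.le fun ζ hζ => ?_
        have hn : ‖ζ‖ = r := by simpa using hζ
        have h4 : ζ ≠ 0 := by rintro rfl; simp at hn; linarith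
        have h5 : ζ - z ≠ 0 := by
          intro h0; rw [sub_eq_zero] at h0; rw [h0] at hn; linarith
        simp only [smul_eq_mul, sub_zero]
        field_simp
        ring
      rw [this, h3, smul_zero]
  rw [key, smul_zero]

lemma integral_Ioo_polar (g : ℂ → ℂ) (r : ℝ) :
    ∫ θ in Ioo (-Real.pi) Real.pi, g (circleMap 0 r θ)
      = (2 * Real.pi : ℝ) • Real.circleAverage g 0 r := by
  have hper : Function.Periodic (fun θ => g (circleMap 0 r θ)) (2 * Real.pi) := fun θ => by
    simp [periodic_circleMap 0 r θ]
  have h := hper.intervalIntegral_add_eq (-Real.pi) 0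
  rw [← integral_Ioc_eq_integral_Ioo, ← intervalIntegral.integral_of_le (by linarith [Real.pi_pos]),
    Real.circleAverage_def, smul_smul, mul_inv_cancel₀ (by positivity), one_smul]
  convert h using 2 <;> ring

lemma integrableOn_polarCoord_target {f : ℂ → ℂ} (hm : Measurable f) (hf : Integrable f) :
    IntegrableOn (fun p : ℝ × ℝ => p.1 • f (Complex.polarCoord.symm p)) polarCoord.target := by
  have hsymm : Measurable fun p : ℝ × ℝ => Complex.polarCoord.symm p := by
    simp only [Complex.polarCoord_symm_apply]; fun_prop
  refine ⟨(by fun_prop : Measurable _).aestronglyMeasurable, ?_⟩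
  have h := Complex.lintegral_comp_polarCoord_symm (fun ζ => ‖f ζ‖ₑ)
  rw [hasFiniteIntegral_iff_enorm]
  calc ∫⁻ p in polarCoord.target, ‖p.1 • f (Complex.polarCoord.symm p)‖ₑ
      = ∫⁻ p in polarCoord.target, ENNReal.ofReal p.1 • ‖f (Complex.polarCoord.symm p)‖ₑ := by
        refine setLIntegral_congr_fun polarCoord.open_target.measurableSet fun p hp => ?_
        rw [polarCoord_target] at hp
        rw [enorm_smul, Real.enorm_of_nonneg hp.1.le, smul_eq_mul]
    _ < ⊤ := by rw [h]; exact hf.2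

/-- The Cauchy transform of a disc is conjugate linear inside the disc. -/
lemma integral_ball_inv_sub {R : ℝ} {z : ℂ} (hz : ‖z‖ < R) :
    ∫ ζ in ball (0 : ℂ) R, (ζ - z)⁻¹ = -(Real.pi : ℂ) * (starRingEnd ℂ) z := by
  set f : ℂ → ℂ := (ball (0 : ℂ) R).indicator fun ζ => (ζ - z)⁻¹ with hf
  have hm : Measurable f := Measurable.indicator (by fun_prop) measurableSet_ball
  have hi : Integrable f :=
    (integrable_indicator_iff measurableSet_ball).2 (integrableOn_inv_sub isBounded_ball z)
  rw [← integral_indicator measurableSet_ball, ← hf, ← Complex.integral_comp_polarCoord_symm]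
  have hi' := integrableOn_polarCoord_target hm hi
  rw [polarCoord_target] at hi' ⊢
  rw [Measure.volume_eq_prod, setIntegral_prod _ hi']
  -- Only circles of radius below `‖z‖` contribute, each with average `-z⁻¹`. The radius `‖z‖`,
  -- where the pole lies on the circle, is discarded as a null set. Integrating over `r` leaves `-2π
  -- z⁻¹ ‖z‖²/2 = -π conj z`.
  have inner : ∀ᵐ r : ℝ, r ∈ Ioi (0 : ℝ) →
      ∫ θ in Ioo (-Real.pi) Real.pi, (r, θ).1 • f (Complex.polarCoord.symm (r, θ))
      = (Ioc 0 ‖z‖).indicator (fun r : ℝ => -(2 * Real.pi * z⁻¹) * (r : ℂ)) r := by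
    filter_upwards [compl_mem_ae_iff.2 (measure_singleton ‖z‖)] with r hrz hr
    have hr0 : 0 < r := hr
    have hrz' : r ≠ ‖z‖ := hrz
    have hmap : ∀ θ : ℝ, Complex.polarCoord.symm (r, θ) = circleMap 0 r θ := fun θ => by
      rw [Complex.polarCoord_symm_apply, circleMap, Complex.exp_mul_I]; simp
    simp only [hmap]
    rw [integral_smul]
    have hn : ∀ θ : ℝ, ‖circleMap 0 r θ‖ = r := fun θ => by simp [abs_of_pos hr0]
    by_cases hrR : r < R
    · have : ∀ θ : ℝ, f (circleMap 0 r θ) = (fun ζ => (ζ - z)⁻¹) (circleMap 0 r θ) := fun θ => by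
        rw [hf, indicator_of_mem]
        rw [mem_ball_zero_iff, hn]; exact hrR
      simp only [this]
      rw [integral_Ioo_polar (fun ζ => (ζ - z)⁻¹) r]
      rcases lt_or_gt_of_ne hrz' with h | h
      · rw [circleAverage_inv_sub_of_lt hr0 h, indicator_of_mem (by exact ⟨hr0, h.le⟩)]
        simp only [Complex.real_smul]
        push_cast
        ring
      · rw [circleAverage_inv_sub_of_gt h, indicator_of_notMem (fun h' => absurd h'.2 (not_le.2 h))]
        simp
    · have : ∀ θ : ℝ, f (circleMap 0 r θ) = 0 := fun θ => by
        rw [hf, indicator_of_notMem]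
        rw [mem_ball_zero_iff, hn]; exact hrR
      rw [indicator_of_notMem (fun h' => absurd (h'.2.trans_lt hz) hrR)]
      simp [this]
  rw [setIntegral_congr_ae measurableSet_Ioi inner, setIntegral_indicator measurableSet_Ioc,
    inter_eq_self_of_subset_right (fun r hr => hr.1),
    ← intervalIntegral.integral_of_le (norm_nonneg z), intervalIntegral.integral_const_mul,
    intervalIntegral.integral_ofReal, integral_id]
  by_cases hz0 : z = 0
  · simp [hz0]
  · have h2 : ((‖z‖ : ℂ)) ^ 2 = z * (starRingEnd ℂ) z := by
      rw [Complex.mul_conj, Complex.normSq_eq_norm_sq]; push_cast; rfl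
    push_cast
    rw [h2]
    field_simp
    ring

/-! ### The Beurling transform of an indicator function -/

/-- Differentiation under the integral sign. For `z` in the half ball every point of `E` is at
distance at least `δ / 2`, so constants dominate, and they are integrable because `E` has finite
measure. -/
lemma hasDerivAt_integral_inv_pow {E : Set ℂ} (hfin : volume E ≠ ⊤) (hE : MeasurableSet E)
    {z₀ : ℂ} {δ : ℝ} (hδ : 0 < δ) (hd : Disjoint (ball z₀ δ) E) (n : ℕ) :
    HasDerivAt (fun z => ∫ ζ in E, ((ζ - z) ^ n)⁻¹)
      (n * ∫ ζ in E, ((ζ - z₀) ^ (n + 1))⁻¹) z₀ := by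
  have hfar : ∀ ζ ∈ E, ∀ z ∈ ball z₀ (δ / 2), δ / 2 ≤ ‖ζ - z‖ := by
    intro ζ hζ z hz
    have h1 : δ ≤ dist ζ z₀ := by
      by_contra h
      exact Set.disjoint_left.1 hd (mem_ball.2 (not_le.1 h)) hζ
    rw [← dist_eq_norm]
    have := dist_triangle ζ z z₀
    have := mem_ball.1 hz
    linarith
  have hne : ∀ ζ ∈ E, ∀ z ∈ ball z₀ (δ / 2), ζ - z ≠ 0 := fun ζ hζ z hz =>
    norm_pos_iff.1 (lt_of_lt_of_le (by positivity) (hfar ζ hζ z hz))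
  have hbound : ∀ m : ℕ, ∀ ζ ∈ E, ∀ z ∈ ball z₀ (δ / 2),
      ‖((ζ - z) ^ m)⁻¹‖ ≤ ((δ / 2) ^ m)⁻¹ := by
    intro m ζ hζ z hz
    rw [norm_inv, norm_pow]
    exact inv_anti₀ (by positivity) (pow_le_pow_left₀ (by positivity) (hfar ζ hζ z hz) m)
  have hmeas : ∀ m : ℕ, ∀ z : ℂ, Measurable fun ζ : ℂ => ((ζ - z) ^ m)⁻¹ := fun m z => by fun_prop
  have hz₀ : z₀ ∈ ball z₀ (δ / 2) := mem_ball_self (by positivity)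
  have : IsFiniteMeasure (volume.restrict E) := ⟨by simpa using hfin.lt_top⟩
  have key := hasDerivAt_integral_of_dominated_loc_of_deriv_le (μ := volume.restrict E)
    (F := fun z ζ => ((ζ - z) ^ n)⁻¹) (F' := fun z ζ => n * ((ζ - z) ^ (n + 1))⁻¹) (x₀ := z₀)
    (bound := fun _ => n * ((δ / 2) ^ (n + 1))⁻¹) (isOpen_ball.mem_nhds hz₀)
    (Eventually.of_forall fun z => (hmeas n z).aestronglyMeasurable)
    ((integrable_const (((δ / 2) ^ n)⁻¹)).mono' (hmeas n z₀).aestronglyMeasurable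
      ((ae_restrict_iff' hE).2 (Eventually.of_forall fun ζ hζ => hbound n ζ hζ z₀ hz₀)))
    ((hmeas (n + 1) z₀).const_mul _).aestronglyMeasurable
    ((ae_restrict_iff' hE).2 (Eventually.of_forall fun ζ hζ z hz => by
      rw [norm_mul, Complex.norm_natCast]
      exact mul_le_mul_of_nonneg_left (hbound (n + 1) ζ hζ z hz) (Nat.cast_nonneg n)))
    (integrable_const _)
    ((ae_restrict_iff' hE).2 (Eventually.of_forall fun ζ hζ z hz => by
      have h0 := hne ζ hζ z hz
      have h := (((hasDerivAt_id z).const_sub ζ).fun_pow n).fun_inv (pow_ne_zero n h0)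
      refine h.congr_deriv ?_
      simp only [id]
      rcases n with _ | n
      · simp
      · simp only [Nat.add_sub_cancel]
        field_simp
        ring))
  rw [← integral_const_mul]
  exact key.2

lemma solT_eq (Ω : Set ℂ) (f : ℂ → ℂ) (z : ℂ) :
    solT Ω f z = -(Real.pi : ℂ)⁻¹ * ∫ ζ in Ω, f ζ * (ζ - z)⁻¹ := by
  have hpi : (Real.pi : ℂ) ≠ 0 := Complex.ofReal_ne_zero.2 Real.pi_ne_zero
  have hI : Complex.I ≠ 0 := Complex.I_ne_zero
  rw [solT, integral_mul_const]
  simp only [div_eq_mul_inv]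
  field_simp

/-- The Beurling transform of the indicator function of `Ω` at points of `Ω`, computed on the
complement of `Ω` in a disc. -/
noncomputable def beurling (Ω : Set ℂ) (R : ℝ) (z : ℂ) : ℂ :=
  (Real.pi : ℂ)⁻¹ * ∫ ζ in ball 0 R \ Ω, ((ζ - z) ^ 2)⁻¹

lemma volume_ball_diff_ne_top (Ω : Set ℂ) (R : ℝ) : volume (ball (0 : ℂ) R \ Ω) ≠ ⊤ :=
  ((measure_mono sdiff_subset).trans_lt measure_ball_lt_top).ne

lemma disjoint_ball_diff {Ω : Set ℂ} {z : ℂ} {δ : ℝ} (h : ball z δ ⊆ Ω) (R : ℝ) :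
    Disjoint (ball z δ) (ball 0 R \ Ω) :=
  Set.disjoint_left.2 fun _ h1 h2 => h2.2 (h h1)

lemma hasDerivAt_beurling {Ω : Set ℂ} (hΩ : IsOpen Ω) (R : ℝ) {z : ℂ} (hz : z ∈ Ω) :
    HasDerivAt (beurling Ω R)
      ((Real.pi : ℂ)⁻¹ * (2 * ∫ ζ in ball 0 R \ Ω, ((ζ - z) ^ 3)⁻¹)) z := by
  obtain ⟨δ, hδ, hb⟩ := Metric.isOpen_iff.1 hΩ z hz
  have := hasDerivAt_integral_inv_pow (volume_ball_diff_ne_top Ω R)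
    (measurableSet_ball.diff hΩ.measurableSet) hδ (disjoint_ball_diff hb R) 2
  exact (this.const_mul _)

lemma integral_inv_sub_eq {Ω : Set ℂ} (hΩ : IsOpen Ω) {R : ℝ} (hR : Ω ⊆ ball 0 R) {z : ℂ}
    (hz : z ∈ Ω) : ∫ ζ in Ω, (ζ - z)⁻¹
      = -(Real.pi : ℂ) * (starRingEnd ℂ) z - ∫ ζ in ball 0 R \ Ω, ((ζ - z) ^ 1)⁻¹ := by
  have hi := integrableOn_inv_sub (isBounded_ball (x := (0 : ℂ)) (r := R)) z
  have hzR : ‖z‖ < R := by simpa using hR hz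
  have h := setIntegral_sdiff hΩ.measurableSet hi hR
  simp only [pow_one]
  rw [h, integral_ball_inv_sub hzR]
  ring

/-- The Cauchy transform of the indicator function of `Ω` is differentiable in `Ω`. -/
lemma hasFDerivAt_solT_one {Ω : Set ℂ} (hΩ : IsOpen Ω) {R : ℝ} (hR : Ω ⊆ ball 0 R) {z : ℂ}
    (hz : z ∈ Ω) : HasFDerivAt (solT Ω fun _ => 1)
      ((beurling Ω R z) • (1 : ℂ →L[ℝ] ℂ) + (Complex.conjCLE : ℂ →L[ℝ] ℂ)) z := by
  have hpi : (Real.pi : ℂ) ≠ 0 := Complex.ofReal_ne_zero.2 Real.pi_ne_zero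
  obtain ⟨δ, hδ, hb⟩ := Metric.isOpen_iff.1 hΩ z hz
  have h1 := (hasDerivAt_integral_inv_pow (volume_ball_diff_ne_top Ω R)
    (measurableSet_ball.diff hΩ.measurableSet) hδ (disjoint_ball_diff hb R) 1).const_mul
      (Real.pi : ℂ)⁻¹
  have h2 := h1.hasFDerivAt.restrictScalars ℝ
  have h3 : HasFDerivAt (fun w : ℂ => (starRingEnd ℂ) w) (Complex.conjCLE : ℂ →L[ℝ] ℂ) z :=
    Complex.conjCLE.hasFDerivAt
  have h4 := h2.add h3
  have heq : (solT Ω fun _ => 1) =ᶠ[𝓝 z] fun w =>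
      ((Real.pi : ℂ)⁻¹ * ∫ ζ in ball 0 R \ Ω, ((ζ - w) ^ 1)⁻¹) + (starRingEnd ℂ) w := by
    filter_upwards [hΩ.mem_nhds hz] with w hw
    rw [solT_eq]
    simp only [one_mul]
    rw [integral_inv_sub_eq hΩ hR hw]
    field_simp
    ring
  refine (h4.congr_of_eventuallyEq heq).congr_fderiv ?_
  ext
  simp [beurling, mul_comm]

/-! ### Singular integrals over the region below a graph -/

lemma integral_abs_sub_add_rpow {a d : ℝ} (ha : a < 1) (hd : 0 < d) (x₀ : ℝ) :
    Integrable (fun x : ℝ => (|x - x₀| + d) ^ (a - 2)) ∧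
    ∫ x : ℝ, (|x - x₀| + d) ^ (a - 2) = 2 * (d ^ (a - 1) / (1 - a)) := by
  have h1a : 0 < 1 - a := by linarith
  have hG : ∀ x ∈ Ici (0 : ℝ), HasDerivAt (fun x : ℝ => -((x + d) ^ (a - 1) / (1 - a)))
      ((x + d) ^ (a - 2)) x := by
    intro x hx
    have hx' : x + d ≠ 0 := by have : (0 : ℝ) ≤ x := hx; positivity
    have h := ((((hasDerivAt_id x).add_const d).rpow_const (p := a - 1)
      (Or.inl hx')).div_const (1 - a)).fun_neg
    refine h.congr_deriv ?_
    simp only [id]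
    rw [show a - 1 - 1 = a - 2 by ring]
    field_simp
    ring
  have ht : Tendsto (fun x : ℝ => -((x + d) ^ (a - 1) / (1 - a))) atTop (𝓝 0) := by
    have h := tendsto_rpow_neg_atTop h1a
    rw [neg_sub] at h
    have h2 := ((h.comp (tendsto_atTop_add_const_right atTop d tendsto_id)).div_const (1 - a)).neg
    simpa using h2
  have hval : ∫ x in Ioi (0 : ℝ), (x + d) ^ (a - 2) = d ^ (a - 1) / (1 - a) := by
    rw [integral_Ioi_of_hasDerivAt_of_nonneg' hG (fun x hx => by
      have : (0 : ℝ) < x := hx; positivity) ht]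
    simp
  have h0 : ∫ x : ℝ, (|x| + d) ^ (a - 2) = 2 * (d ^ (a - 1) / (1 - a)) := by
    rw [integral_comp_abs (f := fun x => (x + d) ^ (a - 2)), hval]
  have hint : ∫ x : ℝ, (|x - x₀| + d) ^ (a - 2) = 2 * (d ^ (a - 1) / (1 - a)) := by
    rw [integral_sub_right_eq_self (fun x : ℝ => (|x| + d) ^ (a - 2)) x₀, h0]
  refine ⟨?_, hint⟩
  -- A non-integrable function has integral `0` by convention, so the positive value just computed
  -- forces integrability.
  by_contra h
  rw [integral_undef h] at hint
  have : 0 < d ^ (a - 1) / (1 - a) := by positivity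
  linarith

/-- Distance to a Lipschitz graph, measured vertically. -/
lemma le_norm_graph_sub {φ : ℝ → ℝ} {L : ℝ} (hL : ∀ s t, |φ s - φ t| ≤ L * |s - t|) (hL0 : 0 ≤ L)
    (z : ℂ) (x : ℝ) :
    |x - z.re| + (z.im - φ z.re) ≤ (2 + L) * ‖((x : ℂ) + φ x * Complex.I) - z‖ := by
  have h1 : |x - z.re| ≤ ‖((x : ℂ) + φ x * Complex.I) - z‖ := by
    simpa using Complex.abs_re_le_norm (((x : ℂ) + φ x * Complex.I) - z)
  have h2 : |φ x - z.im| ≤ ‖((x : ℂ) + φ x * Complex.I) - z‖ := by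
    simpa using Complex.abs_im_le_norm (((x : ℂ) + φ x * Complex.I) - z)
  have h3 := hL x z.re
  have h4 := abs_le.1 h2
  have h5 := abs_le.1 h3
  have h6 := mul_le_mul_of_nonneg_left h1 hL0
  nlinarith

/-- A `C^{1,α}` graph with globally bounded slope. -/
structure IsHolderGraph (α L K : ℝ) (φ φ' : ℝ → ℝ) : Prop where
  hasDerivAt : ∀ x, HasDerivAt φ (φ' x) x
  continuous_deriv : Continuous φ'
  bound : ∀ x, |φ' x| ≤ L
  holder : ∀ s t, |φ' s - φ' t| ≤ K * |s - t| ^ α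

namespace IsHolderGraph

variable {α L K : ℝ} {φ φ' : ℝ → ℝ}

lemma nonneg_slope (h : IsHolderGraph α L K φ φ') : 0 ≤ L := (abs_nonneg _).trans (h.bound 0)

lemma nonneg_holder (h : IsHolderGraph α L K φ φ') : 0 ≤ K := by
  have := h.holder 1 0
  simp at this
  exact (abs_nonneg _).trans this

lemma continuous (h : IsHolderGraph α L K φ φ') : Continuous φ :=
  continuous_iff_continuousAt.2 fun x => (h.hasDerivAt x).continuousAt

lemma lipschitz (h : IsHolderGraph α L K φ φ') (s t : ℝ) : |φ s - φ t| ≤ L * |s - t| := by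
  have := convex_univ.norm_image_sub_le_of_norm_hasDerivWithin_le (f := φ) (f' := φ') (C := L)
    (fun x _ => (h.hasDerivAt x).hasDerivWithinAt) (fun x _ => h.bound x) (mem_univ t) (mem_univ s)
  simpa using this

lemma hasDerivAt_curve (h : IsHolderGraph α L K φ φ') (x : ℝ) :
    HasDerivAt (fun x : ℝ => (x : ℂ) + φ x * Complex.I) (1 + φ' x * Complex.I) x :=
  (Complex.ofRealCLM.hasDerivAt (x := x)).add ((h.hasDerivAt x).ofReal_comp.mul_const _)

lemma one_le_norm_deriv_curve (φ' : ℝ → ℝ) (x : ℝ) : 1 ≤ ‖(1 : ℂ) + φ' x * Complex.I‖ := by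
  have := Complex.abs_re_le_norm ((1 : ℂ) + φ' x * Complex.I)
  simpa using this

lemma deriv_curve_ne_zero (φ' : ℝ → ℝ) (x : ℝ) : (1 : ℂ) + φ' x * Complex.I ≠ 0 :=
  norm_pos_iff.1 (zero_lt_one.trans_le (one_le_norm_deriv_curve φ' x))

lemma norm_deriv_curve_le (h : IsHolderGraph α L K φ φ') (x : ℝ) :
    ‖(1 : ℂ) + φ' x * Complex.I‖ ≤ 1 + L := by
  refine (norm_add_le _ _).trans ?_
  have := h.bound x
  simpa using this

/-- Inversion is 1-Lipschitz outside the open unit disc, and the tangent vectors have real part `1`,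
so the Hölder constant of the slope is kept. -/
lemma norm_inv_deriv_sub_le (h : IsHolderGraph α L K φ φ') (s t : ℝ) :
    ‖((1 : ℂ) + φ' s * Complex.I)⁻¹ - ((1 : ℂ) + φ' t * Complex.I)⁻¹‖ ≤ K * |s - t| ^ α := by
  rw [inv_sub_inv (deriv_curve_ne_zero φ' s) (deriv_curve_ne_zero φ' t), norm_div, norm_mul]
  have h1 := one_le_norm_deriv_curve φ' s
  have h2 := one_le_norm_deriv_curve φ' t
  have h3 : ‖(1 : ℂ) + φ' t * Complex.I - (1 + φ' s * Complex.I)‖ = |φ' s - φ' t| := by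
    rw [show (1 : ℂ) + φ' t * Complex.I - (1 + φ' s * Complex.I)
      = -(((φ' s - φ' t : ℝ) : ℂ) * Complex.I) by push_cast; ring]
    rw [norm_neg, norm_mul, Complex.norm_I, mul_one, Complex.norm_real, Real.norm_eq_abs]
  rw [h3]
  refine (div_le_self (abs_nonneg _) ?_).trans (h.holder s t)
  nlinarith

variable {z : ℂ}

lemma norm_inv_sq_le (h : IsHolderGraph α L K φ φ') (hz : φ z.re < z.im) (x : ℝ) :
    ‖((((x : ℂ) + φ x * Complex.I) - z) ^ 2)⁻¹‖
      ≤ (2 + L) ^ 2 * (|x - z.re| + (z.im - φ z.re)) ^ (-2 : ℝ) := by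
  have hL := h.nonneg_slope
  have h1 := le_norm_graph_sub h.lipschitz hL z x
  have hd : 0 < |x - z.re| + (z.im - φ z.re) := by have := abs_nonneg (x - z.re); linarith
  have hn : 0 < ‖((x : ℂ) + φ x * Complex.I) - z‖ := by
    by_contra hc
    have : ‖((x : ℂ) + φ x * Complex.I) - z‖ = 0 := le_antisymm (not_lt.1 hc) (norm_nonneg _)
    rw [this] at h1; linarith
  rw [Real.rpow_neg hd.le, norm_inv, norm_pow, ← div_eq_mul_inv, Real.rpow_two,
    inv_le_comm₀ (by positivity) (by positivity), inv_div, ← div_pow]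
  refine pow_le_pow_left₀ (by positivity) ?_ 2
  rw [div_le_iff₀ (by positivity)]
  linarith

lemma curve_ne (hz : φ z.re < z.im) (x : ℝ) : ((x : ℂ) + φ x * Complex.I) - z ≠ 0 := by
  intro h0
  have h1 := congrArg Complex.re h0
  have h2 := congrArg Complex.im h0
  simp at h1 h2
  have : x = z.re := by linarith
  subst this
  linarith

lemma integrable_curve (h : IsHolderGraph α L K φ φ') (hz : φ z.re < z.im) :
    Integrable fun x : ℝ =>
      (1 + φ' x * Complex.I) * ((((x : ℂ) + φ x * Complex.I) - z) ^ 2)⁻¹ := by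
  have hd : 0 < z.im - φ z.re := by linarith
  have hi := ((integral_abs_sub_add_rpow (a := 0) zero_lt_one hd z.re).1).const_mul
    ((1 + L) * (2 + L) ^ 2)
  refine hi.mono' ?_ (Eventually.of_forall fun x => ?_)
  · have := h.continuous.measurable
    have := h.continuous_deriv.measurable
    exact (by fun_prop : Measurable _).aestronglyMeasurable
  · rw [norm_mul, mul_assoc, zero_sub]
    exact mul_le_mul (h.norm_deriv_curve_le x) (h.norm_inv_sq_le hz x) (norm_nonneg _)
      (by have := h.nonneg_slope; linarith)

lemma tendsto_inv_curve (φ : ℝ → ℝ) (z : ℂ) {l : Filter ℝ} (hl : Tendsto (fun x : ℝ => |x|) l atTop) :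
    Tendsto (fun x : ℝ => -(((x : ℂ) + φ x * Complex.I) - z)⁻¹) l (𝓝 0) := by
  rw [← neg_zero]
  refine Tendsto.neg (tendsto_inv₀_cobounded.comp ?_)
  rw [← tendsto_norm_atTop_iff_cobounded]
  refine tendsto_atTop_mono (f := fun x => |x| - ‖z‖) (fun x => ?_)
    (tendsto_atTop_add_const_right _ _ hl)
  have h1 : |x| ≤ ‖(x : ℂ) + φ x * Complex.I‖ := by
    simpa using Complex.abs_re_le_norm ((x : ℂ) + φ x * Complex.I)
  have h2 := norm_sub_norm_le ((x : ℂ) + φ x * Complex.I) z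
  linarith

/-- The integrand is the derivative of `-1/(γ - z)` along the graph, which tends to zero at both
ends. This is the cancellation behind `norm_integral_inv_sq_le`. -/
lemma integral_curve (h : IsHolderGraph α L K φ φ') (hz : φ z.re < z.im) :
    ∫ x : ℝ, (1 + φ' x * Complex.I) * ((((x : ℂ) + φ x * Complex.I) - z) ^ 2)⁻¹ = 0 := by
  have := integral_of_hasDerivAt_of_tendsto (f := fun x : ℝ => -(((x : ℂ) + φ x * Complex.I) - z)⁻¹)
    (fun x => ?_) (h.integrable_curve hz) (tendsto_inv_curve φ z tendsto_abs_atBot_atTop)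
    (tendsto_inv_curve φ z tendsto_abs_atTop_atTop)
  · simpa using this
  · have h1 := (((h.hasDerivAt_curve x).sub_const z).fun_inv (curve_ne hz x)).fun_neg
    refine h1.congr_deriv ?_
    rw [neg_div, neg_neg, div_eq_mul_inv]

/-- The Hölder cancellation estimate. -/
lemma norm_integral_inv_sq_le (h : IsHolderGraph α L K φ φ') (hz : φ z.re < z.im)
    (hα0 : 0 ≤ α) (hα : α < 1) :
    ‖∫ x : ℝ, ((((x : ℂ) + φ x * Complex.I) - z) ^ 2)⁻¹‖
      ≤ K * (1 + L) * (2 + L) ^ 2 * (2 * ((z.im - φ z.re) ^ (α - 1) / (1 - α))) := by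
  have hd : 0 < z.im - φ z.re := by linarith
  have hL := h.nonneg_slope
  have hK := h.nonneg_holder
  obtain ⟨hi, hv⟩ := integral_abs_sub_add_rpow hα hd z.re
  have hm : Integrable fun x : ℝ => ((((x : ℂ) + φ x * Complex.I) - z) ^ 2)⁻¹ := by
    have hi' := ((integral_abs_sub_add_rpow (a := 0) zero_lt_one hd z.re).1).const_mul ((2 + L) ^ 2)
    refine hi'.mono' ?_ (Eventually.of_forall fun x => ?_)
    · have := h.continuous.measurable
      exact (by fun_prop : Measurable _).aestronglyMeasurable
    · rw [zero_sub]; exact h.norm_inv_sq_le hz x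
  -- The inverse tangent vector at the point of the graph below `z`. Subtracting `c` times the
  -- vanishing integral gains a factor `|x - z.re| ^ α`, which improves the exponent `-2` to `α - 2`
  -- and the resulting bound to the height to the power `α - 1`.
  set c : ℂ := ((1 : ℂ) + φ' z.re * Complex.I)⁻¹
  have h1 : ∫ x : ℝ, ((((x : ℂ) + φ x * Complex.I) - z) ^ 2)⁻¹
      = ∫ x : ℝ, (((1 : ℂ) + φ' x * Complex.I)⁻¹ - c) *
        ((1 + φ' x * Complex.I) * ((((x : ℂ) + φ x * Complex.I) - z) ^ 2)⁻¹) := by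
    rw [← sub_zero (∫ x : ℝ, ((((x : ℂ) + φ x * Complex.I) - z) ^ 2)⁻¹),
      ← mul_zero c, ← h.integral_curve hz, ← integral_const_mul,
      ← integral_sub hm ((h.integrable_curve hz).const_mul c)]
    congr 1
    ext x
    have := deriv_curve_ne_zero φ' x
    rw [sub_mul, inv_mul_cancel_left₀ this]
  rw [h1, ← hv, ← integral_const_mul]
  refine norm_integral_le_of_norm_le (hi.const_mul _) (Eventually.of_forall fun x => ?_)
  have hp : 0 < |x - z.re| + (z.im - φ z.re) := by have := abs_nonneg (x - z.re); linarith
  rw [norm_mul, norm_mul]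
  have e1 := h.norm_inv_deriv_sub_le x z.re
  have e2 := h.norm_deriv_curve_le x
  have e3 := h.norm_inv_sq_le hz x
  have e4 : |x - z.re| ^ α ≤ (|x - z.re| + (z.im - φ z.re)) ^ α :=
    Real.rpow_le_rpow (abs_nonneg _) (by linarith) hα0
  calc _ ≤ (K * (|x - z.re| + (z.im - φ z.re)) ^ α) * ((1 + L) *
          ((2 + L) ^ 2 * (|x - z.re| + (z.im - φ z.re)) ^ (-2 : ℝ))) := by
        gcongr
        exact e1.trans (by gcongr)
    _ = K * (1 + L) * (2 + L) ^ 2 * ((|x - z.re| + (z.im - φ z.re)) ^ α *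
          (|x - z.re| + (z.im - φ z.re)) ^ (-2 : ℝ)) := by ring
    _ = _ := by rw [← Real.rpow_add hp]; ring_nf

end IsHolderGraph

/-! ### Area integrals of the cubic kernel below a graph -/

lemma integrableOn_inv_cube_of_isClosed {A : Set ℂ} (hA : IsClosed A) {z : ℂ} (hz : z ∉ A) :
    IntegrableOn (fun ζ : ℂ => ((ζ - z) ^ 3)⁻¹) A := by
  obtain ⟨a, ha, hb⟩ := Metric.isOpen_iff.1 hA.isOpen_compl z hz
  have h2 : IntegrableOn (fun ζ : ℂ => ((ζ - z) ^ 3)⁻¹) (ball z a)ᶜ := by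
    refine Integrable.mono' (integral_cube_far ha z).1
      (by fun_prop : Measurable _).aestronglyMeasurable ?_
    exact Eventually.of_forall fun ζ => by rw [norm_inv, norm_pow]
  exact h2.mono_set (subset_compl_comm.1 hb)

namespace IsHolderGraph

variable {α L K : ℝ} {φ φ' : ℝ → ℝ} {z : ℂ}

lemma isClosed_subgraph (h : IsHolderGraph α L K φ φ') : IsClosed {ζ : ℂ | ζ.im ≤ φ ζ.re} :=
  isClosed_le Complex.continuous_im (h.continuous.comp Complex.continuous_re)

lemma integrableOn_subgraph (h : IsHolderGraph α L K φ φ') (hz : φ z.re < z.im) :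
    IntegrableOn (fun ζ : ℂ => ((ζ - z) ^ 3)⁻¹) {ζ : ℂ | ζ.im ≤ φ ζ.re} :=
  integrableOn_inv_cube_of_isClosed h.isClosed_subgraph (not_le.2 hz)

/-- Along a vertical line `(I / 2) (ζ - z)⁻²` is a primitive that vanishes at `-∞`. Integrability is
left as a hypothesis because Fubini supplies it for almost every `x`. -/
lemma integral_vertical {x : ℝ} (hne : ∀ y ∈ Iic (φ x), (x : ℂ) + y * Complex.I - z ≠ 0)
    (hi : IntegrableOn (fun y : ℝ => (((x : ℂ) + y * Complex.I - z) ^ 3)⁻¹) (Iic (φ x))) :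
    ∫ y in Iic (φ x), (((x : ℂ) + y * Complex.I - z) ^ 3)⁻¹
      = Complex.I / 2 * (((x : ℂ) + φ x * Complex.I - z) ^ 2)⁻¹ := by
  have hlim : Tendsto (fun y : ℝ => Complex.I / 2 * (((x : ℂ) + y * Complex.I - z) ^ 2)⁻¹)
      atBot (𝓝 0) := by
    rw [← mul_zero (Complex.I / 2)]
    refine Tendsto.const_mul _ ?_
    simp only [← inv_pow]
    rw [← zero_pow (M₀ := ℂ) two_ne_zero]
    refine Tendsto.pow (tendsto_inv₀_cobounded.comp ?_) 2
    rw [← tendsto_norm_atTop_iff_cobounded]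
    refine tendsto_atTop_mono (f := fun y => |y| - ‖z‖) (fun y => ?_)
      (tendsto_atTop_add_const_right _ _ tendsto_abs_atBot_atTop)
    have h1 : |y| ≤ ‖(x : ℂ) + y * Complex.I‖ := by
      simpa using Complex.abs_im_le_norm ((x : ℂ) + y * Complex.I)
    have h2 := norm_sub_norm_le ((x : ℂ) + y * Complex.I) z
    linarith
  have key := integral_Iic_of_hasDerivAt_of_tendsto' (a := φ x)
    (f := fun y : ℝ => Complex.I / 2 * (((x : ℂ) + y * Complex.I - z) ^ 2)⁻¹) (fun y hy => ?_) hi hlim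
  · rw [key, sub_zero]
  · have h0 := hne y hy
    have h1 : HasDerivAt (fun y : ℝ => (x : ℂ) + y * Complex.I - z) Complex.I y := by
      have := (((Complex.ofRealCLM.hasDerivAt (x := y)).mul_const Complex.I).const_add
        (x : ℂ)).sub_const z
      simpa using this
    have h2 := ((h1.fun_pow 2).fun_inv (pow_ne_zero 2 h0)).const_mul (Complex.I / 2)
    refine h2.congr_deriv ?_
    generalize (x : ℂ) + y * Complex.I - z = u at h0
    have e : Complex.I / 2 * (-((2 : ℕ) * u ^ (2 - 1) * Complex.I) / (u ^ 2) ^ 2)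
        = -(Complex.I ^ 2) * (u / u ^ 4) := by
      simp only [Nat.add_one_sub_one, pow_one]
      push_cast
      ring
    rw [e, Complex.I_sq]
    field_simp

lemma integral_subgraph_eq (h : IsHolderGraph α L K φ φ') (hz : φ z.re < z.im) :
    ∫ ζ in {ζ : ℂ | ζ.im ≤ φ ζ.re}, ((ζ - z) ^ 3)⁻¹
      = Complex.I / 2 * ∫ x : ℝ, (((x : ℂ) + φ x * Complex.I - z) ^ 2)⁻¹ := by
  set S : Set ℂ := {ζ : ℂ | ζ.im ≤ φ ζ.re} with hS
  have hSm : MeasurableSet S := h.isClosed_subgraph.measurableSet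
  set g : ℂ → ℂ := S.indicator fun ζ => ((ζ - z) ^ 3)⁻¹ with hg
  have hgi : Integrable g := (integrable_indicator_iff hSm).2 (h.integrableOn_subgraph hz)
  have hmp := Complex.volume_preserving_equiv_real_prod.symm
  have hgi' : Integrable (fun p : ℝ × ℝ => g (Complex.measurableEquivRealProd.symm p))
      (volume.prod volume) :=
    (hmp.integrable_comp_emb Complex.measurableEquivRealProd.symm.measurableEmbedding).2 hgi
  rw [← integral_indicator hSm, ← hg, ← hmp.integral_comp', Measure.volume_eq_prod,
    integral_prod _ hgi', ← integral_const_mul]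
  refine integral_congr_ae ?_
  filter_upwards [hgi'.prod_right_ae] with x hx
  have hpt : ∀ y : ℝ, g (Complex.measurableEquivRealProd.symm (x, y))
      = (Iic (φ x)).indicator (fun y : ℝ => (((x : ℂ) + y * Complex.I - z) ^ 3)⁻¹) y := by
    intro y
    have e : Complex.measurableEquivRealProd.symm (x, y) = (x : ℂ) + y * Complex.I := by
      apply Complex.ext <;> simp
    rw [e, hg]
    by_cases hy : y ≤ φ x
    · rw [indicator_of_mem (by simpa [hS] using hy), indicator_of_mem (by exact hy)]
    · rw [indicator_of_notMem (by simpa [hS] using hy), indicator_of_notMem (by exact hy)]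
  simp only [hpt] at hx ⊢
  rw [integral_indicator measurableSet_Iic]
  refine integral_vertical (fun y hy h0 => ?_) ((integrable_indicator_iff measurableSet_Iic).1 hx)
  have h1 := congrArg Complex.re h0
  have h2 := congrArg Complex.im h0
  simp at h1 h2 hy
  have : x = z.re := by linarith
  subst this
  linarith

lemma norm_integral_subgraph_le (h : IsHolderGraph α L K φ φ') (hz : φ z.re < z.im)
    (hα0 : 0 ≤ α) (hα : α < 1) :
    ‖∫ ζ in {ζ : ℂ | ζ.im ≤ φ ζ.re}, ((ζ - z) ^ 3)⁻¹‖
      ≤ K * (1 + L) * (2 + L) ^ 2 / (1 - α) * (z.im - φ z.re) ^ (α - 1) := by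
  rw [h.integral_subgraph_eq hz, norm_mul]
  have h1 := h.norm_integral_inv_sq_le hz hα0 hα
  have h2 : ‖Complex.I / 2‖ = 1 / 2 := by simp
  rw [h2]
  refine (mul_le_mul_of_nonneg_left h1 (by norm_num)).trans (le_of_eq ?_)
  ring

/-! ### From gradient bounds to Hölder continuity -/

/-- Integrating the derivative bound gives `C / α * ((d + H) ^ α - d ^ α)`, and subadditivity of `t
^ α` removes the dependence on the initial height `d`. The estimate is therefore uniform up to the
boundary. -/
lemma norm_sub_vertical_le {b b' : ℂ → ℂ} {C α : ℝ} (hα0 : 0 < α) (hα : α ≤ 1) (hC : 0 ≤ C) {w : ℂ}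
    {d H : ℝ} (hd : 0 < d) (hH : 0 ≤ H)
    (hb : ∀ t ∈ Icc 0 H, HasDerivAt b (b' (w + t * Complex.I)) (w + t * Complex.I))
    (hb' : ∀ t ∈ Icc 0 H, ‖b' (w + t * Complex.I)‖ ≤ C * (d + t) ^ (α - 1)) :
    ‖b (w + H * Complex.I) - b w‖ ≤ C / α * H ^ α := by
  have hline : ∀ t : ℝ, HasDerivAt (fun t : ℝ => w + t * Complex.I) Complex.I t := fun t => by
    have := ((Complex.ofRealCLM.hasDerivAt (x := t)).mul_const Complex.I).const_add w
    simpa using this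
  have hder : ∀ t ∈ Icc 0 H, HasDerivAt (fun t : ℝ => b (w + t * Complex.I) - b w)
      (b' (w + t * Complex.I) * Complex.I) t := fun t ht =>
    (HasDerivAt.comp (h₂ := b) t (hb t ht) (hline t)).sub_const (b w)
  have hB : ∀ t ∈ Icc 0 H, HasDerivAt (fun t : ℝ => C / α * ((d + t) ^ α - d ^ α))
      (C * (d + t) ^ (α - 1)) t := fun t ht => by
    have hdt : d + t ≠ 0 := by have := ht.1; positivity
    have h := ((((hasDerivAt_id t).const_add d).rpow_const (p := α) (Or.inl hdt)).sub_const
      (d ^ α)).const_mul (C / α)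
    refine h.congr_deriv ?_
    simp only [id]
    field_simp
  have key := image_norm_le_of_norm_deriv_right_le_deriv_boundary' (a := 0) (b := H)
    (fun t ht => (hder t ht).continuousAt.continuousWithinAt)
    (fun t ht => (hder t (Ico_subset_Icc_self ht)).hasDerivWithinAt)
    (B := fun t : ℝ => C / α * ((d + t) ^ α - d ^ α)) (by simp)
    (fun t ht => (hB t ht).continuousAt.continuousWithinAt)
    (fun t ht => (hB t (Ico_subset_Icc_self ht)).hasDerivWithinAt)
    (fun t ht => by
      rw [norm_mul, Complex.norm_I, mul_one]
      exact hb' t (Ico_subset_Icc_self ht)) (right_mem_Icc.2 hH)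
  refine key.trans (mul_le_mul_of_nonneg_left ?_ (by positivity))
  have := Real.rpow_add_le_add_rpow hd.le hH hα0.le hα
  linarith

/-- A Hardy–Littlewood lemma in the region above a Lipschitz graph. -/
lemma exists_holder_of_deriv_bound (h : IsHolderGraph α L K φ φ') (hα0 : 0 < α) (hα : α ≤ 1)
    {b b' : ℂ → ℂ} {C r : ℝ} (hC : 0 ≤ C)
    (hb : ∀ w ∈ ball (0 : ℂ) r, φ w.re < w.im → HasDerivAt b (b' w) w)
    (hb' : ∀ w ∈ ball (0 : ℂ) r, φ w.re < w.im → ‖b' w‖ ≤ C * (w.im - φ w.re) ^ (α - 1))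
    {ρ : ℝ} (hρ : ρ * (1 + 2 * (2 + L)) ≤ r) {w₁ w₂ : ℂ}
    (h₁ : w₁ ∈ ball (0 : ℂ) ρ) (h₂ : w₂ ∈ ball (0 : ℂ) ρ) (hw₁ : φ w₁.re < w₁.im)
    (hw₂ : φ w₂.re < w₂.im) :
    ‖b w₁ - b w₂‖ ≤ C * (2 / α * (2 + L) ^ α + 1) * ‖w₁ - w₂‖ ^ α := by
  have hL := h.nonneg_slope
  rcases eq_or_ne w₁ w₂ with rfl | hne
  · simp [Real.zero_rpow hα0.ne']
  set η : ℝ := ‖w₁ - w₂‖ with hη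
  have hη0 : 0 < η := norm_pos_iff.2 (sub_ne_zero.2 hne)
  rw [mem_ball_zero_iff] at h₁ h₂
  have hηρ : η < 2 * ρ := by have := norm_sub_le w₁ w₂; linarith
  -- Raising both points by `H` puts the segment joining them at height at least `η` above the
  -- graph: moving along it costs at most `η` in the imaginary part and `L * η` in `φ`. The
  -- condition on `ρ` keeps the raised points in the ball of radius `r`.
  set H : ℝ := (2 + L) * η with hH
  have hH0 : 0 ≤ H := by positivity
  have hHρ : H ≤ (2 + L) * (2 * ρ) :=
    mul_le_mul_of_nonneg_left hηρ.le (by positivity)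
  have hvert : ∀ w : ℂ, ‖w‖ < ρ → φ w.re < w.im →
      ‖b (w + H * Complex.I) - b w‖ ≤ C / α * H ^ α := by
    intro w hw hw'
    have hin : ∀ t ∈ Icc 0 H, w + t * Complex.I ∈ ball (0 : ℂ) r := fun t ht => by
      rw [mem_ball_zero_iff]
      have h1 := norm_add_le w (t * Complex.I)
      have h2 : ‖(t : ℂ) * Complex.I‖ = t := by simp [abs_of_nonneg ht.1]
      have := ht.2
      nlinarith
    have hab : ∀ t ∈ Icc 0 H, φ (w + t * Complex.I).re < (w + t * Complex.I).im := fun t ht => by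
      have := ht.1
      simp; linarith
    refine norm_sub_vertical_le (d := w.im - φ w.re) (b' := b') hα0 hα hC (by linarith) hH0
      (fun t ht => hb _ (hin t ht) (hab t ht)) (fun t ht => ?_)
    convert hb' _ (hin t ht) (hab t ht) using 3
    simp; ring
  have v1 := hvert w₁ h₁ hw₁
  have v2 := hvert w₂ h₂ hw₂
  have hseg : ∀ w ∈ segment ℝ (w₁ + H * Complex.I) (w₂ + H * Complex.I),
      w ∈ ball (0 : ℂ) r ∧ η ≤ w.im - φ w.re := by
    intro w hw
    have hnI : ‖(H : ℂ) * Complex.I‖ = H := by simp [abs_of_nonneg hH0]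
    constructor
    · refine (convex_ball (0 : ℂ) r).segment_subset ?_ ?_ hw
      · rw [mem_ball_zero_iff]
        have h1 := norm_add_le w₁ (H * Complex.I)
        nlinarith
      · rw [mem_ball_zero_iff]
        have h1 := norm_add_le w₂ (H * Complex.I)
        nlinarith
    · have hd := norm_sub_le_of_mem_segment hw
      have e : w₂ + (H : ℂ) * Complex.I - (w₁ + H * Complex.I) = -(w₁ - w₂) := by ring
      rw [e, norm_neg, ← hη] at hd
      have h1 := Complex.abs_re_le_norm (w - (w₁ + H * Complex.I))
      have h2 := Complex.abs_im_le_norm (w - (w₁ + H * Complex.I))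
      simp at h1 h2
      have h3 := h.lipschitz w.re w₁.re
      have h4 : L * |w.re - w₁.re| ≤ L * η := mul_le_mul_of_nonneg_left (h1.trans hd) hL
      have h5 := abs_le.1 (h3.trans h4)
      have h6 := abs_le.1 (h2.trans hd)
      rw [hH] at h6
      nlinarith [h5.2, h6.1]
  have v3 : ‖b (w₂ + H * Complex.I) - b (w₁ + H * Complex.I)‖ ≤ C * η ^ (α - 1) * η := by
    have := (convex_segment (𝕜 := ℝ) (w₁ + H * Complex.I)
      (w₂ + H * Complex.I)).norm_image_sub_le_of_norm_hasDerivWithin_le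
      (f := b) (f' := b') (C := C * η ^ (α - 1))
      (fun w hw => (hb w (hseg w hw).1 (by have := (hseg w hw).2; linarith)).hasDerivWithinAt)
      (fun w hw => (hb' w (hseg w hw).1 (by have := (hseg w hw).2; linarith)).trans
        (mul_le_mul_of_nonneg_left
          (Real.rpow_le_rpow_of_nonpos hη0 (hseg w hw).2 (by linarith)) hC))
      (left_mem_segment ℝ _ _) (right_mem_segment ℝ _ _)
    refine this.trans (le_of_eq ?_)
    rw [show w₂ + (H : ℂ) * Complex.I - (w₁ + H * Complex.I) = -(w₁ - w₂) by ring, norm_neg]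
  have e1 : C * η ^ (α - 1) * η = C * η ^ α := by
    rw [mul_assoc, ← Real.rpow_add_one hη0.ne']; simp
  have e2 : H ^ α = (2 + L) ^ α * η ^ α := Real.mul_rpow (by positivity) hη0.le
  rw [e1] at v3
  rw [e2] at v1 v2
  have tri : ‖b w₁ - b w₂‖ ≤ ‖b (w₁ + H * Complex.I) - b w₁‖
      + ‖b (w₂ + H * Complex.I) - b (w₁ + H * Complex.I)‖ + ‖b (w₂ + H * Complex.I) - b w₂‖ := by
    have e : b w₁ - b w₂ = -(b (w₁ + H * Complex.I) - b w₁)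
      + -(b (w₂ + H * Complex.I) - b (w₁ + H * Complex.I)) + (b (w₂ + H * Complex.I) - b w₂) := by
      ring
    rw [e]
    refine (norm_add_le _ _).trans (add_le_add_left ((norm_add_le _ _).trans ?_) _)
    rw [norm_neg, norm_neg]
  refine tri.trans ((add_le_add (add_le_add v1 v3) v2).trans (le_of_eq ?_))
  ring

end IsHolderGraph

/-! ### Hölder continuity of the Beurling transform of a `C^{1,α}` domain -/

lemma abs_clamp_sub_le (r s t : ℝ) :
    |max (-r) (min r s) - max (-r) (min r t)| ≤ |s - t| := by
  have h1 := abs_max_sub_max_le_abs (min r s) (min r t) (-r)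
  have h2 := abs_min_sub_min_le_max r s r t
  rw [max_comm (-r), max_comm (-r)]
  refine h1.trans (h2.trans ?_)
  simp

/-- Freezing the slope outside `[-r, r]` makes the slope and Hölder bounds global without changing
the graph near the boundary point. The exponent is lowered to at most `1 / 2` because the estimates
divide by one minus it; on a bounded interval this costs only the factor `(2 * r) ^ (α - β)`. -/
lemma exists_isHolderGraph {φ : ℝ → ℝ} (hφ : ContDiff ℝ 1 φ) {α K : ℝ} (hα : 0 < α)
    (hK : ∀ s t : ℝ, |deriv φ s - deriv φ t| ≤ K * |s - t| ^ α) {r : ℝ} (hr : 0 < r) :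
    ∃ L K' : ℝ, ∃ ψ ψ' : ℝ → ℝ, IsHolderGraph (min α (1 / 2)) L K' ψ ψ' ∧
      ∀ s ∈ Icc (-r) r, ψ s = φ s := by
  set c : ℝ → ℝ := fun t => max (-r) (min r t) with hc
  have hcc : Continuous c := by fun_prop
  have hcm : ∀ t, c t ∈ Icc (-r) r := fun t =>
    ⟨le_max_left _ _, max_le (by linarith) (min_le_left _ _)⟩
  have hci : ∀ t ∈ Icc (-r) r, c t = t := fun t ht => by
    simp only [hc]; rw [min_eq_right ht.2, max_eq_right ht.1]
  have hφd : Continuous (deriv φ) := hφ.continuous_deriv le_rfl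
  have hψc : Continuous fun t => deriv φ (c t) := hφd.comp hcc
  obtain ⟨L, hL⟩ := isCompact_Icc.exists_bound_of_continuousOn (s := Icc (-r) r) hφd.continuousOn
  set β := min α (1 / 2) with hβ
  have hβ0 : 0 < β := lt_min hα (by norm_num)
  have hβα : 0 ≤ α - β := sub_nonneg.2 (min_le_left _ _)
  refine ⟨L, |K| * (2 * r) ^ (α - β), fun x => φ 0 + ∫ t in (0 : ℝ)..x, deriv φ (c t),
    fun t => deriv φ (c t), ⟨fun x => ?_, hψc, fun x => hL _ (hcm x), fun s t => ?_⟩,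
    fun s hs => ?_⟩
  · exact ((hψc.integral_hasStrictDerivAt 0 x).hasDerivAt).const_add _
  · have h1 := abs_clamp_sub_le r s t
    change |c s - c t| ≤ |s - t| at h1
    have h2 : |c s - c t| ≤ 2 * r := by
      rw [abs_le]
      have := (hcm s).1; have := (hcm s).2; have := (hcm t).1; have := (hcm t).2
      constructor <;> linarith
    calc |deriv φ (c s) - deriv φ (c t)| ≤ K * |c s - c t| ^ α := hK _ _
      _ ≤ |K| * |c s - c t| ^ ((α - β) + β) := by
        rw [sub_add_cancel]
        exact mul_le_mul_of_nonneg_right (le_abs_self K) (by positivity)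
      _ = |K| * (|c s - c t| ^ (α - β) * |c s - c t| ^ β) := by
        rw [Real.rpow_add_of_nonneg (abs_nonneg _) hβα hβ0.le]
      _ ≤ |K| * ((2 * r) ^ (α - β) * |s - t| ^ β) := by gcongr
      _ = _ := by ring
  · have h0 : (0 : ℝ) ∈ Icc (-r) r := ⟨by linarith, hr.le⟩
    have h1 : ∫ t in (0 : ℝ)..s, deriv φ (c t) = ∫ t in (0 : ℝ)..s, deriv φ t := by
      refine intervalIntegral.integral_congr fun t ht => ?_
      rw [hci t (uIcc_subset_Icc h0 hs ht)]
    change φ 0 + ∫ t in (0 : ℝ)..s, deriv φ (c t) = φ s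
    rw [h1, intervalIntegral.integral_deriv_eq_sub
      (fun x _ => (hφ.differentiable one_ne_zero).differentiableAt)
      (hφd.intervalIntegrable _ _)]
    ring

lemma norm_setIntegral_inv_cube_le {A : Set ℂ} {z : ℂ} {δ : ℝ} (hδ : 0 < δ)
    (hA : A ⊆ (ball z δ)ᶜ) : ‖∫ ζ in A, ((ζ - z) ^ 3)⁻¹‖ ≤ 2 * Real.pi / δ := by
  obtain ⟨hi, hv⟩ := integral_cube_far hδ z
  rw [← hv]
  refine (norm_integral_le_integral_norm _).trans ?_
  simp only [norm_inv, norm_pow]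
  exact setIntegral_mono_set hi (Eventually.of_forall fun ζ => by positivity)
    (Eventually.of_forall hA)

lemma integral_rigid_inv_cube {a : ℂ} (ha : ‖a‖ = 1) (p z : ℂ) (S : Set ℂ) :
    ∫ ζ in (fun ζ => a * (ζ - p)) ⁻¹' S, ((ζ - z) ^ 3)⁻¹
      = a ^ 3 * ∫ w in S, ((w - a * (z - p)) ^ 3)⁻¹ := by
  have ha0 : a ≠ 0 := by rintro rfl; simp at ha
  let e : ℂ ≃ₗᵢ[ℝ] ℂ := rotation ⟨a, by simpa [Submonoid.unitSphere] using ha⟩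
  have hmp : MeasurePreserving (fun ζ : ℂ => a * (ζ - p)) := by
    have := e.measurePreserving.comp (measurePreserving_sub_right volume p)
    exact this
  have hme : MeasurableEmbedding (fun ζ : ℂ => a * (ζ - p)) := by
    have := e.toHomeomorph.measurableEmbedding.comp (Homeomorph.subRight p).measurableEmbedding
    exact this
  rw [← hmp.setIntegral_preimage_emb hme (fun w => ((w - a * (z - p)) ^ 3)⁻¹) S,
    ← integral_const_mul]
  congr 1
  ext ζ
  rw [show a * (ζ - p) - a * (z - p) = a * (ζ - z) by ring, mul_pow, mul_inv,
    mul_inv_cancel_left₀ (pow_ne_zero 3 ha0)]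

/-- Inside `ball p r` the complement of `Ω` coincides with a rotated subgraph. The two sets differ
only at distance at least `r / 2` from `z`, and each of the two tails contributes at most `4π / r`.
-/
lemma norm_integral_compl_le {Ω : Set ℂ} (hΩ : IsOpen Ω) {R : ℝ} {p a : ℂ} (ha : ‖a‖ = 1)
    {r : ℝ} (hr : 0 < r) (hpR : ball p r ⊆ ball 0 R) {β L K : ℝ} {φ φ' : ℝ → ℝ}
    (h : IsHolderGraph β L K φ φ') (hβ0 : 0 ≤ β) (hβ : β < 1)
    (hloc : ∀ ζ ∈ ball p r, ζ ∈ Ω ↔ φ (a * (ζ - p)).re < (a * (ζ - p)).im)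
    {z : ℂ} (hz : z ∈ ball p (r / 2)) (hzΩ : z ∈ Ω) :
    ‖∫ ζ in ball 0 R \ Ω, ((ζ - z) ^ 3)⁻¹‖
      ≤ K * (1 + L) * (2 + L) ^ 2 / (1 - β) *
          ((a * (z - p)).im - φ (a * (z - p)).re) ^ (β - 1) + 8 * Real.pi / r := by
  have hzr : z ∈ ball p r := ball_subset_ball (by linarith) hz
  have hgr := (hloc z hzr).1 hzΩ
  set S : Set ℂ := (fun ζ => a * (ζ - p)) ⁻¹' {ζ : ℂ | ζ.im ≤ φ ζ.re} with hS
  have hSc : IsClosed S := h.isClosed_subgraph.preimage (by fun_prop)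
  have hzS : z ∉ S := fun hc => absurd hgr (not_lt.2 hc)
  set E : Set ℂ := ball 0 R \ Ω with hE
  have hEi : IntegrableOn (fun ζ : ℂ => ((ζ - z) ^ 3)⁻¹) E :=
    (integrableOn_inv_cube_of_isClosed hΩ.isClosed_compl (not_not.2 hzΩ)).mono_set
      fun _ hζ => hζ.2
  have hSi := integrableOn_inv_cube_of_isClosed hSc hzS
  have hES : E ∩ ball p r = S ∩ ball p r := by
    ext ζ
    constructor
    · rintro ⟨h1, h2⟩
      exact ⟨not_lt.1 fun hc => h1.2 ((hloc ζ h2).2 hc), h2⟩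
    · rintro ⟨h1, h2⟩
      exact ⟨⟨hpR h2, fun hc => absurd ((hloc ζ h2).1 hc) (not_lt.2 h1)⟩, h2⟩
  have h1 := integral_inter_add_sdiff (t := ball p r) measurableSet_ball hEi
  have h2 := integral_inter_add_sdiff (t := ball p r) measurableSet_ball hSi
  have hfar : (ball p r)ᶜ ⊆ (ball z (r / 2))ᶜ := by
    refine compl_subset_compl.2 fun ζ hζ => ?_
    rw [mem_ball] at hz hζ ⊢
    have := dist_triangle ζ z p
    linarith
  have b1 := norm_setIntegral_inv_cube_le (A := E \ ball p r) (z := z) (half_pos hr)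
    (fun ζ hζ => hfar hζ.2)
  have b2 := norm_setIntegral_inv_cube_le (A := S \ ball p r) (z := z) (half_pos hr)
    (fun ζ hζ => hfar hζ.2)
  have b3 := h.norm_integral_subgraph_le hgr hβ0 hβ
  have h3 := integral_rigid_inv_cube ha p z {ζ : ℂ | ζ.im ≤ φ ζ.re}
  rw [← hS] at h3
  have e : ∫ ζ in E, ((ζ - z) ^ 3)⁻¹ = (∫ ζ in S, ((ζ - z) ^ 3)⁻¹)
      - (∫ ζ in S \ ball p r, ((ζ - z) ^ 3)⁻¹) + ∫ ζ in E \ ball p r, ((ζ - z) ^ 3)⁻¹ := by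
    rw [← h1, ← h2, hES]; ring
  rw [e, h3]
  refine (norm_add_le _ _).trans ((add_le_add (norm_sub_le _ _) le_rfl).trans ?_)
  rw [norm_mul, norm_pow, ha, one_pow, one_mul]
  have : 8 * Real.pi / r = 2 * Real.pi / (r / 2) + 2 * Real.pi / (r / 2) := by
    field_simp; ring
  linarith

lemma exists_holder_beurling_frontier {Ω : Set ℂ} (hΩ : IsOpen Ω) {R : ℝ}
    (hR : closure Ω ⊆ ball 0 R) {α : ℝ} (hα : 0 < α) (hb : HasC1HolderBoundary α Ω) {p : ℂ}
    (hp : p ∈ frontier Ω) : ∃ ρ : ℝ, 0 < ρ ∧ ∃ C : ℝ, ∀ z ∈ Ω ∩ ball p ρ, ∀ w ∈ Ω ∩ ball p ρ,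
      ‖beurling Ω R z - beurling Ω R w‖ ≤ C * ‖z - w‖ ^ min α (1 / 2) := by
  obtain ⟨r₀, hr₀, a, ha, φ₀, hφ₀, ⟨K₀, hK₀⟩, hloc₀⟩ := hb p hp
  obtain ⟨r₁, hr₁, hpR₁⟩ := Metric.isOpen_iff.1 isOpen_ball p (hR hp.1)
  set r := min r₀ r₁ with hr_def
  have hr : 0 < r := lt_min hr₀ hr₁
  have hpR : ball p r ⊆ ball 0 R := (ball_subset_ball (min_le_right _ _)).trans hpR₁
  obtain ⟨L, K, φ, φ', h, heq⟩ := exists_isHolderGraph hφ₀ hα hK₀ hr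
  set β := min α (1 / 2) with hβ_def
  have hβ0 : 0 < β := lt_min hα (by norm_num)
  have hβ : β < 1 := lt_of_le_of_lt (min_le_right _ _) (by norm_num)
  have ha0 : a ≠ 0 := by rintro rfl; simp at ha
  have hL := h.nonneg_slope
  have hK := h.nonneg_holder
  have hnT : ∀ ζ, ‖a * (ζ - p)‖ = dist ζ p := fun ζ => by rw [norm_mul, ha, one_mul, dist_eq_norm]
  have hloc : ∀ ζ ∈ ball p r, ζ ∈ Ω ↔ φ (a * (ζ - p)).re < (a * (ζ - p)).im := by
    intro ζ hζ
    rw [hloc₀ ζ (ball_subset_ball (min_le_left _ _) hζ), heq]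
    have h1 := Complex.abs_re_le_norm (a * (ζ - p))
    rw [hnT] at h1
    exact abs_le.1 (h1.trans (mem_ball.1 hζ).le)
  let Q : ℂ → ℂ := fun w => p + a⁻¹ * w
  have hTQ : ∀ w, a * (Q w - p) = w := fun w => by
    simp only [Q]; rw [add_sub_cancel_left, mul_inv_cancel_left₀ ha0]
  have hQT : ∀ ζ, Q (a * (ζ - p)) = ζ := fun ζ => by
    simp only [Q]; rw [inv_mul_cancel_left₀ ha0]; ring
  have hQball : ∀ {s : ℝ} {w : ℂ}, w ∈ ball (0 : ℂ) s → Q w ∈ ball p s := fun {s w} hw => by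
    rw [mem_ball, ← hnT, hTQ]; simpa using hw
  have hQΩ : ∀ w ∈ ball (0 : ℂ) (r / 2), φ w.re < w.im → Q w ∈ Ω := fun w hw hw' => by
    rw [hloc (Q w) (ball_subset_ball (by linarith) (hQball hw)), hTQ]; exact hw'
  set b' : ℂ → ℂ := fun w =>
    (Real.pi : ℂ)⁻¹ * (2 * ∫ ζ in ball 0 R \ Ω, ((ζ - Q w) ^ 3)⁻¹) * a⁻¹ with hb'_def
  -- An upper bound for the height above the graph in the half ball. It gives `D ^ (1 - β)` times
  -- the height to the power `β - 1` at least `1`, so the constant tail is absorbed into the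
  -- singular term.
  set D : ℝ := (2 + L) * (|φ 0| + r) with hD
  have hD0 : 0 < D := by positivity
  set C₀ : ℝ := K * (1 + L) * (2 + L) ^ 2 / (1 - β) with hC₀
  have hC₀0 : 0 ≤ C₀ := by
    have : 0 < 1 - β := by linarith
    positivity
  set C : ℝ := Real.pi⁻¹ * (2 * (C₀ + 8 * Real.pi / r * D ^ (1 - β))) with hC
  have hC0 : 0 ≤ C := by positivity
  have hder : ∀ w ∈ ball (0 : ℂ) (r / 2), φ w.re < w.im →
      HasDerivAt (fun w => beurling Ω R (Q w)) (b' w) w := by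
    intro w hw hw'
    have h1 := hasDerivAt_beurling hΩ R (hQΩ w hw hw')
    have h2 : HasDerivAt Q a⁻¹ w := by
      have h3 := ((hasDerivAt_id w).const_mul a⁻¹).const_add p
      rw [mul_one] at h3
      exact h3
    exact h1.comp w h2
  have hbound : ∀ w ∈ ball (0 : ℂ) (r / 2), φ w.re < w.im →
      ‖b' w‖ ≤ C * (w.im - φ w.re) ^ (β - 1) := by
    intro w hw hw'
    have h1 := norm_integral_compl_le hΩ ha hr hpR h hβ0.le hβ hloc (hQball hw) (hQΩ w hw hw')
    rw [hTQ] at h1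
    have hd : 0 < w.im - φ w.re := by linarith
    have hdD : w.im - φ w.re ≤ D := by
      have h2 := le_norm_graph_sub h.lipschitz hL w 0
      have h3 : ‖((0 : ℝ) : ℂ) + φ 0 * Complex.I - w‖ ≤ |φ 0| + r := by
        have h4 : ‖w‖ < r / 2 := by simpa using hw
        refine (norm_sub_le _ _).trans (add_le_add ?_ (by linarith))
        simp
      have h5 := mul_le_mul_of_nonneg_left h3 (by positivity : 0 ≤ 2 + L)
      have := abs_nonneg (0 - w.re)
      linarith
    have h1D : 1 ≤ D ^ (1 - β) * (w.im - φ w.re) ^ (β - 1) := by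
      rw [show β - 1 = -(1 - β) by ring, Real.rpow_neg hd.le, ← div_eq_mul_inv,
        one_le_div (by positivity)]
      exact Real.rpow_le_rpow hd.le hdD (by linarith)
    have hna : ‖a⁻¹‖ = 1 := by rw [norm_inv, ha, inv_one]
    simp only [hb'_def]
    rw [norm_mul, norm_mul, norm_mul, hna, mul_one, norm_inv, Complex.norm_real, Real.norm_eq_abs,
      abs_of_pos Real.pi_pos, Complex.norm_two, hC, mul_assoc, mul_assoc]
    refine mul_le_mul_of_nonneg_left ?_ (by positivity)
    refine mul_le_mul_of_nonneg_left (h1.trans ?_) (by positivity)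
    rw [add_mul, mul_assoc (8 * Real.pi / r)]
    refine add_le_add le_rfl ?_
    exact le_mul_of_one_le_right (by positivity) h1D
  -- The largest radius allowed by `exists_holder_of_deriv_bound` when the derivative bound holds on
  -- the ball of radius `r / 2`.
  set ρ : ℝ := r / 2 / (1 + 2 * (2 + L)) with hρ
  refine ⟨ρ, by positivity, C * (2 / β * (2 + L) ^ β + 1), fun z hz w hw => ?_⟩
  have hρr : ρ * (1 + 2 * (2 + L)) = r / 2 := by rw [hρ]; field_simp
  have hρr' : ρ ≤ r := by
    rw [hρ, div_le_iff₀ (by positivity)]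
    nlinarith
  have hmem : ∀ ζ ∈ Ω ∩ ball p ρ, a * (ζ - p) ∈ ball (0 : ℂ) ρ ∧
      φ (a * (ζ - p)).re < (a * (ζ - p)).im := fun ζ hζ =>
    ⟨by rw [mem_ball_zero_iff, hnT]; exact hζ.2, (hloc ζ (ball_subset_ball hρr' hζ.2)).1 hζ.1⟩
  have key := h.exists_holder_of_deriv_bound hβ0 hβ.le hC0 hder hbound hρr.le
    (hmem z hz).1 (hmem w hw).1 (hmem z hz).2 (hmem w hw).2
  simp only [hQT] at key
  rwa [show a * (z - p) - a * (w - p) = a * (z - w) by ring, norm_mul, ha, one_mul] at key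

lemma exists_holder_beurling_interior {Ω : Set ℂ} (hΩ : IsOpen Ω) (R : ℝ) {β : ℝ}
    (hβ : β ≤ 1) {p : ℂ} (hp : p ∈ Ω) :
    ∃ ρ : ℝ, 0 < ρ ∧ ∃ C : ℝ, ∀ z ∈ Ω ∩ ball p ρ, ∀ w ∈ Ω ∩ ball p ρ,
      ‖beurling Ω R z - beurling Ω R w‖ ≤ C * ‖z - w‖ ^ β := by
  obtain ⟨δ, hδ, hb⟩ := Metric.isOpen_iff.1 hΩ p hp
  set M : ℝ := Real.pi⁻¹ * (2 * (2 * Real.pi / (δ / 2))) with hM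
  have hM0 : 0 ≤ M := by positivity
  refine ⟨δ / 2, half_pos hδ, M * δ ^ (1 - β), fun z hz w hw => ?_⟩
  rcases eq_or_ne z w with rfl | hne
  · simp; positivity
  have hlip := (convex_ball p (δ / 2)).norm_image_sub_le_of_norm_hasDerivWithin_le
    (f := beurling Ω R) (C := M)
    (fun x hx => (hasDerivAt_beurling hΩ R
      (hb (ball_subset_ball (by linarith) hx))).hasDerivWithinAt)
    (fun x hx => by
      rw [norm_mul, norm_mul, norm_inv, Complex.norm_real, Real.norm_eq_abs,
        abs_of_pos Real.pi_pos, Complex.norm_two, hM]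
      refine mul_le_mul_of_nonneg_left ?_ (by positivity)
      refine mul_le_mul_of_nonneg_left ?_ (by positivity)
      refine norm_setIntegral_inv_cube_le (half_pos hδ) fun ζ hζ hc => hζ.2 (hb ?_)
      rw [mem_ball] at hx hc ⊢
      have := dist_triangle ζ x p
      linarith) hw.2 hz.2
  have h0 : 0 < ‖z - w‖ := norm_pos_iff.2 (sub_ne_zero.2 hne)
  have h1 : ‖z - w‖ ≤ δ := by
    rw [← dist_eq_norm]
    have := dist_triangle_right z w p
    have := mem_ball.1 hz.2
    have := mem_ball.1 hw.2
    linarith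
  refine hlip.trans ?_
  rw [mul_assoc M]
  refine mul_le_mul_of_nonneg_left ?_ hM0
  calc ‖z - w‖ = ‖z - w‖ ^ (1 - β) * ‖z - w‖ ^ β := by
        rw [← Real.rpow_add h0]; simp
    _ ≤ δ ^ (1 - β) * ‖z - w‖ ^ β := by
        gcongr

/-- The Beurling transform of the indicator function of a bounded `C^{1,α}` domain is bounded and
Hölder continuous in the domain. -/
theorem exists_holder_beurling {Ω : Set ℂ} (hΩ : IsOpen Ω) {R : ℝ} (hR : closure Ω ⊆ ball 0 R)
    {α : ℝ} (hα : 0 < α) (hb : HasC1HolderBoundary α Ω) :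
    ∃ β M : ℝ, 0 < β ∧ 0 ≤ M ∧ (∀ z ∈ Ω, ‖beurling Ω R z‖ ≤ M) ∧
      ∀ z ∈ Ω, ∀ w ∈ Ω, ‖beurling Ω R z - beurling Ω R w‖ ≤ M * ‖z - w‖ ^ β := by
  set β := min α (1 / 2) with hβ_def
  have hβ0 : 0 < β := lt_min hα (by norm_num)
  have hβ : β ≤ 1 := (min_le_right _ _).trans (by norm_num)
  have hcomp : IsCompact (closure Ω) :=
    (isCompact_closedBall (0 : ℂ) R).of_isClosed_subset isClosed_closure
      (hR.trans ball_subset_closedBall)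
  have hlocal : ∀ p ∈ closure Ω, ∃ ρ : ℝ, 0 < ρ ∧ ∃ C : ℝ, ∀ z ∈ Ω ∩ ball p ρ,
      ∀ w ∈ Ω ∩ ball p ρ, ‖beurling Ω R z - beurling Ω R w‖ ≤ C * ‖z - w‖ ^ β := by
    intro p hp
    by_cases hpΩ : p ∈ Ω
    · exact exists_holder_beurling_interior hΩ R hβ hpΩ
    · exact exists_holder_beurling_frontier hΩ hR hα hb ⟨hp, by rwa [hΩ.interior_eq]⟩
  have hbdd : ∃ M : ℝ, ∀ z ∈ Ω ∩ closure Ω, ‖beurling Ω R z‖ ≤ M := by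
    refine hcomp.induction_on (p := fun s => ∃ M : ℝ, ∀ z ∈ Ω ∩ s, ‖beurling Ω R z‖ ≤ M)
      ⟨0, by simp⟩ (fun s t hst ⟨M, hM⟩ => ⟨M, fun z hz => hM z ⟨hz.1, hst hz.2⟩⟩) ?_ ?_
    · rintro s t ⟨M, hM⟩ ⟨N, hN⟩
      refine ⟨max M N, fun z hz => ?_⟩
      rcases hz.2 with h | h
      · exact (hM z ⟨hz.1, h⟩).trans (le_max_left _ _)
      · exact (hN z ⟨hz.1, h⟩).trans (le_max_right _ _)
    · intro p hp
      obtain ⟨ρ, hρ, C, hC⟩ := hlocal p hp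
      refine ⟨ball p ρ, mem_nhdsWithin_of_mem_nhds (ball_mem_nhds p hρ), ?_⟩
      obtain ⟨w, hw, hwρ⟩ := Metric.mem_closure_iff.1 hp ρ hρ
      have hw' : w ∈ Ω ∩ ball p ρ := ⟨hw, by rwa [mem_ball, dist_comm]⟩
      refine ⟨‖beurling Ω R w‖ + |C| * (2 * ρ) ^ β, fun z hz => ?_⟩
      have h1 := hC z hz w hw'
      have h2 : ‖z - w‖ ≤ 2 * ρ := by
        rw [← dist_eq_norm]
        have := dist_triangle_right z w p
        have := mem_ball.1 hz.2
        have := mem_ball.1 hw'.2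
        linarith
      have h3 : C * ‖z - w‖ ^ β ≤ |C| * (2 * ρ) ^ β :=
        mul_le_mul (le_abs_self C) (Real.rpow_le_rpow (norm_nonneg _) h2 hβ0.le) (by positivity)
          (abs_nonneg C)
      have h4 := norm_sub_norm_le (beurling Ω R z) (beurling Ω R w)
      linarith
  -- A Lebesgue number argument: only `z` is localized, and halving the local radius keeps every `w`
  -- near `z` in the same ball. Compactness then gives one `δ` and one constant for all nearby
  -- pairs.
  have hunif : ∃ δ : ℝ, 0 < δ ∧ ∃ C : ℝ, ∀ z ∈ Ω ∩ closure Ω, ∀ w ∈ Ω, ‖z - w‖ < δ →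
      ‖beurling Ω R z - beurling Ω R w‖ ≤ C * ‖z - w‖ ^ β := by
    refine hcomp.induction_on (p := fun s => ∃ δ : ℝ, 0 < δ ∧ ∃ C : ℝ, ∀ z ∈ Ω ∩ s, ∀ w ∈ Ω,
      ‖z - w‖ < δ → ‖beurling Ω R z - beurling Ω R w‖ ≤ C * ‖z - w‖ ^ β)
      ⟨1, one_pos, 0, by simp⟩
      (fun s t hst ⟨δ, hδ, C, hC⟩ => ⟨δ, hδ, C, fun z hz => hC z ⟨hz.1, hst hz.2⟩⟩) ?_ ?_
    · rintro s t ⟨δ, hδ, C, hC⟩ ⟨ε, hε, D, hD⟩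
      refine ⟨min δ ε, lt_min hδ hε, max C D, fun z hz w hw hzw => ?_⟩
      rcases hz.2 with h | h
      · exact (hC z ⟨hz.1, h⟩ w hw (hzw.trans_le (min_le_left _ _))).trans
          (mul_le_mul_of_nonneg_right (le_max_left _ _) (by positivity))
      · exact (hD z ⟨hz.1, h⟩ w hw (hzw.trans_le (min_le_right _ _))).trans
          (mul_le_mul_of_nonneg_right (le_max_right _ _) (by positivity))
    · intro p hp
      obtain ⟨ρ, hρ, C, hC⟩ := hlocal p hp
      refine ⟨ball p (ρ / 2), mem_nhdsWithin_of_mem_nhds (ball_mem_nhds p (half_pos hρ)),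
        ρ / 2, half_pos hρ, C, fun z hz w hw hzw => ?_⟩
      refine hC z ⟨hz.1, ball_subset_ball (by linarith) hz.2⟩ w ⟨hw, ?_⟩
      rw [← dist_eq_norm] at hzw
      have := dist_triangle_left w p z
      have := mem_ball.1 hz.2
      rw [mem_ball]
      linarith
  obtain ⟨M, hM⟩ := hbdd
  obtain ⟨δ, hδ, C, hC⟩ := hunif
  have hM' : ∀ z ∈ Ω, ‖beurling Ω R z‖ ≤ |M| := fun z hz =>
    (hM z ⟨hz, subset_closure hz⟩).trans (le_abs_self M)
  refine ⟨β, max |M| (max |C| (2 * |M| / δ ^ β)), hβ0, (abs_nonneg M).trans (le_max_left _ _),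
    fun z hz => (hM' z hz).trans (le_max_left _ _), fun z hz w hw => ?_⟩
  -- Pairs at distance at least `δ` are handled by boundedness alone, whence the constant `2 * |M| /
  -- δ ^ β`.
  by_cases hzw : ‖z - w‖ < δ
  · refine (hC z ⟨hz, subset_closure hz⟩ w hw hzw).trans
      (mul_le_mul_of_nonneg_right ?_ (by positivity))
    exact (le_abs_self C).trans ((le_max_left _ _).trans (le_max_right _ _))
  · have h1 : ‖beurling Ω R z - beurling Ω R w‖ ≤ 2 * |M| :=
      (norm_sub_le _ _).trans (by linarith [hM' z hz, hM' w hw])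
    have h2 : δ ^ β ≤ ‖z - w‖ ^ β := Real.rpow_le_rpow hδ.le (not_lt.1 hzw) hβ0.le
    calc _ ≤ 2 * |M| := h1
      _ = 2 * |M| / δ ^ β * δ ^ β := by field_simp
      _ ≤ _ := by
        refine mul_le_mul ((le_max_right _ _).trans (le_max_right _ _)) h2 (by positivity) ?_
        exact (abs_nonneg M).trans (le_max_left _ _)

/-! ### Cauchy potentials of log-continuous densities -/

/-- Quantitative form of membership in `C^{0, Log^ν L}(Ω)`. -/
structure IsLogCont (ν N : ℝ) (Ω : Set ℂ) (f : ℂ → ℂ) : Prop where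
  nonneg : 0 ≤ N
  continuousOn : ContinuousOn f Ω
  bound : ∀ z ∈ Ω, ‖f z‖ ≤ N
  modulus : ∀ z ∈ Ω, ∀ w ∈ Ω, z ≠ w → ‖w - z‖ < 1 → ‖f w - f z‖ ≤ N * (-Real.log ‖w - z‖) ^ (-ν)

/-- The regularized kernel of the second-order singular integral. -/
noncomputable def regKernel (f : ℂ → ℂ) (z ζ : ℂ) : ℂ := (f ζ - f z) * ((ζ - z) ^ 2)⁻¹

/-- The scale `1 / 9` lies below `1 / e`, and it is exactly the range in which `3h ≤ √h`, as needed
in `norm_integral_regKernel_sub_le`. -/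
lemma one_le_neg_log {h : ℝ} (h0 : 0 < h) (h1 : h ≤ 1 / 9) : 1 ≤ -Real.log h := by
  have h2 : Real.log h ≤ Real.log (Real.exp (-1)) := by
    refine Real.log_le_log h0 (h1.trans ?_)
    rw [Real.exp_neg, one_div]
    exact inv_anti₀ (Real.exp_pos 1) (by linarith [Real.exp_one_lt_d9])
  rw [Real.log_exp] at h2
  linarith

/-- Any positive power beats any power of the logarithm: raise the bound on `|log h| * h ^ (β / μ)`
to the power `μ`. This turns Hölder estimates into logarithmic ones. -/
lemma rpow_le_neg_log_rpow {β μ h : ℝ} (hβ : 0 < β) (hμ : 0 < μ) (h0 : 0 < h) (h1 : h < 1) :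
    h ^ β ≤ (μ / β) ^ μ * (-Real.log h) ^ (-μ) := by
  have hl : 0 < -Real.log h := neg_pos.2 (Real.log_neg h0 h1)
  have key := (Real.abs_log_mul_self_rpow_lt h (β / μ) h0 h1.le (by positivity)).le
  rw [abs_mul, abs_of_neg (neg_pos.1 hl), abs_of_pos (by positivity), one_div_div] at key
  have h2 := Real.rpow_le_rpow (by positivity) key hμ.le
  rw [Real.mul_rpow hl.le (by positivity), ← Real.rpow_mul h0.le, div_mul_cancel₀ _ hμ.ne'] at h2
  rw [Real.rpow_neg hl.le, ← div_eq_mul_inv, le_div_iff₀ (by positivity)]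
  linarith

namespace IsLogCont

variable {ν N : ℝ} {Ω : Set ℂ} {f : ℂ → ℂ}

lemma norm_sub_le (hf : IsLogCont ν N Ω f) {z w : ℂ} (hz : z ∈ Ω) (hw : w ∈ Ω) :
    ‖f w - f z‖ ≤ 2 * N :=
  (_root_.norm_sub_le _ _).trans (by linarith [hf.bound z hz, hf.bound w hw])

lemma aestronglyMeasurable (hf : IsLogCont ν N Ω f) (hΩ : IsOpen Ω) :
    AEStronglyMeasurable f (volume.restrict Ω) :=
  hf.continuousOn.aestronglyMeasurable hΩ.measurableSet

lemma integrableOn_mul_inv_sub (hf : IsLogCont ν N Ω f) (hΩ : IsOpen Ω)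
    (hb : Bornology.IsBounded Ω) (z : ℂ) : IntegrableOn (fun ζ => f ζ * (ζ - z)⁻¹) Ω :=
  (integrableOn_inv_sub hb z).bdd_mul (hf.aestronglyMeasurable hΩ)
    ((ae_restrict_iff' hΩ.measurableSet).2 (Eventually.of_forall hf.bound))

lemma subset_ball_of_mem {R : ℝ} (hR : Ω ⊆ ball 0 R) {z : ℂ} (hz : z ∈ Ω) :
    Ω ⊆ ball z (2 * R) := fun ζ hζ => by
  have h1 := mem_ball.1 (hR hζ)
  have h2 := mem_ball.1 (hR hz)
  rw [mem_ball]
  linarith [dist_triangle_right ζ z 0]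

lemma norm_solT_le (hf : IsLogCont ν N Ω f) (hΩ : IsOpen Ω) {R : ℝ} (hR : Ω ⊆ ball 0 R) {z : ℂ}
    (hz : z ∈ Ω) : ‖solT Ω f z‖ ≤ 4 * R * N := by
  have hsub := subset_ball_of_mem hR hz
  have hR0 : 0 ≤ R := by
    have h2 := mem_ball.1 (hR hz)
    linarith [dist_nonneg (x := z) (y := 0)]
  obtain ⟨hi, hv⟩ := ball_integral_rpow (s := 1) (by norm_num) (by positivity : 0 ≤ 2 * R) z
  rw [solT_eq, norm_mul, norm_neg, norm_inv, Complex.norm_real, Real.norm_eq_abs,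
    abs_of_pos Real.pi_pos]
  have h1 : ‖∫ ζ in Ω, f ζ * (ζ - z)⁻¹‖ ≤ ∫ ζ in Ω, N * ‖ζ - z‖ ^ (-1 : ℝ) := by
    refine norm_integral_le_of_norm_le ((hi.mono_set hsub).const_mul N) ?_
    refine (ae_restrict_iff' hΩ.measurableSet).2 (Eventually.of_forall fun ζ hζ => ?_)
    rw [norm_mul, norm_inv, Real.rpow_neg_one]
    exact mul_le_mul_of_nonneg_right (hf.bound ζ hζ) (by positivity)
  have h2 : ∫ ζ in Ω, ‖ζ - z‖ ^ (-1 : ℝ) ≤ 2 * Real.pi * (2 * R) := by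
    refine (setIntegral_mono_set hi (Eventually.of_forall fun ζ => by
      simp only [Pi.zero_apply]; positivity) (Eventually.of_forall hsub)).trans (le_of_eq ?_)
    rw [hv]
    norm_num
  rw [integral_const_mul] at h1
  calc _ ≤ Real.pi⁻¹ * (N * (2 * Real.pi * (2 * R))) := by
        refine mul_le_mul_of_nonneg_left (h1.trans ?_) (by positivity)
        exact mul_le_mul_of_nonneg_left h2 hf.nonneg
    _ = _ := by field_simp; ring

lemma aestronglyMeasurable_regKernel (hf : IsLogCont ν N Ω f) (hΩ : IsOpen Ω) (z : ℂ) :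
    AEStronglyMeasurable (regKernel f z) (volume.restrict Ω) := by
  refine ((hf.aestronglyMeasurable hΩ).sub aestronglyMeasurable_const).mul ?_
  exact (by fun_prop : Measurable fun ζ : ℂ => ((ζ - z) ^ 2)⁻¹).aestronglyMeasurable

/-- Here the Dini integral converges because `ν > 1`, and one power of the logarithm is lost. The
set `A` need not be centred at `z`, so that a ball around one pole can be used for the kernel with
another pole. -/
lemma regKernel_near (hf : IsLogCont ν N Ω f) (hΩ : IsOpen Ω) (hν : 1 < ν) {z : ℂ} (hz : z ∈ Ω)
    {b : ℝ} (hb0 : 0 ≤ b) (hb1 : b < 1) {A : Set ℂ} (hA : MeasurableSet A)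
    (hAs : A ⊆ Ω ∩ ball z b) :
    IntegrableOn (regKernel f z) A ∧ ‖∫ ζ in A, regKernel f z ζ‖
      ≤ N * (2 * Real.pi * ((-Real.log b) ^ (1 - ν) / (ν - 1))) := by
  obtain ⟨hi, hv⟩ := ball_integral_log hν hb0 hb1 z
  have hAb : A ⊆ ball z b := fun ζ hζ => (hAs hζ).2
  have hlog : ∀ ζ ∈ ball z b, 0 ≤ -Real.log ‖ζ - z‖ := fun ζ hζ => by
    rw [mem_ball, dist_eq_norm] at hζ
    exact neg_nonneg.2 (Real.log_nonpos (norm_nonneg _) (hζ.trans hb1).le)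
  have hpt : ∀ᵐ ζ ∂(volume.restrict A), ‖regKernel f z ζ‖ ≤
      N * ((-Real.log ‖ζ - z‖) ^ (-ν) * (‖ζ - z‖ ^ 2)⁻¹) := by
    refine (ae_restrict_iff' hA).2 (Eventually.of_forall fun ζ hζ => ?_)
    rcases eq_or_ne z ζ with rfl | hne
    · simp [regKernel]
    rw [regKernel, norm_mul, norm_inv, norm_pow, ← mul_assoc]
    refine mul_le_mul_of_nonneg_right (hf.modulus z hz ζ (hAs hζ).1 hne ?_) (by positivity)
    have := (hAs hζ).2
    rw [mem_ball, dist_eq_norm] at this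
    exact this.trans hb1
  have hi' := (hi.mono_set hAb).const_mul N
  refine ⟨hi'.mono' ((hf.aestronglyMeasurable_regKernel hΩ z).mono_set fun ζ hζ => (hAs hζ).1) hpt,
    (norm_integral_le_of_norm_le hi' hpt).trans ?_⟩
  rw [integral_const_mul, ← hv]
  refine mul_le_mul_of_nonneg_left ?_ hf.nonneg
  refine setIntegral_mono_set hi ?_ (Eventually.of_forall hAb)
  refine (ae_restrict_iff' measurableSet_ball).2 (Eventually.of_forall fun ζ hζ => ?_)
  have := hlog ζ hζ
  simp only [Pi.zero_apply]
  positivity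

lemma regKernel_far (hf : IsLogCont ν N Ω f) (hΩ : IsOpen Ω) {z : ℂ} (hz : z ∈ Ω)
    {a b : ℝ} (ha : 0 < a) (hab : a ≤ b) {A : Set ℂ} (hA : MeasurableSet A)
    (hAs : A ⊆ Ω ∩ {ζ | ‖ζ - z‖ ∈ Ico a b}) :
    IntegrableOn (regKernel f z) A ∧ ‖∫ ζ in A, regKernel f z ζ‖
      ≤ 2 * N * (2 * Real.pi * (Real.log b - Real.log a)) := by
  obtain ⟨hi, hv⟩ := annulus_integral_sq ha hab z
  have hAb : A ⊆ {ζ | ‖ζ - z‖ ∈ Ico a b} := fun ζ hζ => (hAs hζ).2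
  have hpt : ∀ᵐ ζ ∂(volume.restrict A), ‖regKernel f z ζ‖ ≤ 2 * N * (‖ζ - z‖ ^ 2)⁻¹ := by
    refine (ae_restrict_iff' hA).2 (Eventually.of_forall fun ζ hζ => ?_)
    rw [regKernel, norm_mul, norm_inv, norm_pow]
    exact mul_le_mul_of_nonneg_right (hf.norm_sub_le hz (hAs hζ).1) (by positivity)
  have hi' := (hi.mono_set hAb).const_mul (2 * N)
  refine ⟨hi'.mono' ((hf.aestronglyMeasurable_regKernel hΩ z).mono_set fun ζ hζ => (hAs hζ).1) hpt,
    (norm_integral_le_of_norm_le hi' hpt).trans ?_⟩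
  rw [integral_const_mul, ← hv]
  refine mul_le_mul_of_nonneg_left ?_ (by have := hf.nonneg; positivity)
  exact setIntegral_mono_set hi (Eventually.of_forall fun ζ => by positivity)
    (Eventually.of_forall hAb)

lemma regKernel_all (hf : IsLogCont ν N Ω f) (hΩ : IsOpen Ω) (hν : 1 < ν) {R : ℝ} (hR1 : 1 ≤ R)
    (hR : Ω ⊆ ball 0 R) {z : ℂ} (hz : z ∈ Ω) :
    IntegrableOn (regKernel f z) Ω ∧ ‖∫ ζ in Ω, regKernel f z ζ‖
      ≤ (2 * Real.pi * ((-Real.log (1 / 2)) ^ (1 - ν) / (ν - 1))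
        + 2 * (2 * Real.pi * (Real.log (2 * R) - Real.log (1 / 2)))) * N := by
  have h1 := hf.regKernel_near hΩ hν hz (b := 1 / 2) (by norm_num) (by norm_num)
    (hΩ.measurableSet.inter measurableSet_ball) subset_rfl
  have hsub : Ω \ ball z (1 / 2) ⊆ Ω ∩ {ζ | ‖ζ - z‖ ∈ Ico (1 / 2) (2 * R)} := fun ζ hζ => by
    refine ⟨hζ.1, ?_, ?_⟩
    · rw [← dist_eq_norm]; exact not_lt.1 hζ.2
    · rw [← dist_eq_norm]; exact subset_ball_of_mem hR hz hζ.1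
  have h2 := hf.regKernel_far hΩ hz (by norm_num) (by linarith)
    (hΩ.measurableSet.diff measurableSet_ball) hsub
  have hi : IntegrableOn (regKernel f z) Ω := by
    have := h1.1.union h2.1
    rwa [inter_union_sdiff] at this
  refine ⟨hi, ?_⟩
  rw [← integral_inter_add_sdiff (t := ball z (1 / 2)) measurableSet_ball hi]
  refine (norm_add_le _ _).trans ((add_le_add h1.2 h2.2).trans (le_of_eq ?_))
  ring

/-! #### The modulus of continuity of the singular integral -/

lemma norm_inv_sq_sub_inv_sq_le {z w ζ : ℂ} (hzw : 0 < ‖z - w‖) (h : 2 * ‖z - w‖ ≤ ‖ζ - z‖) :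
    ‖ζ - z‖ / 2 ≤ ‖ζ - w‖ ∧
    ‖((ζ - z) ^ 2)⁻¹ - ((ζ - w) ^ 2)⁻¹‖ ≤ 10 * (‖z - w‖ / ‖ζ - z‖) * (‖ζ - z‖ ^ 2)⁻¹ := by
  set h₀ := ‖z - w‖
  set r := ‖ζ - z‖ with hr
  have hr0 : 0 < r := by linarith
  have e1 : ζ - z = (ζ - w) - (z - w) := by ring
  have e2 : ζ - w = (ζ - z) + (z - w) := by ring
  have t1 : r ≤ ‖ζ - w‖ + h₀ := by rw [hr, e1]; exact _root_.norm_sub_le _ _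
  have t2 : ‖ζ - w‖ ≤ r + h₀ := by rw [e2]; exact norm_add_le _ _
  have hw : r / 2 ≤ ‖ζ - w‖ := by linarith
  refine ⟨hw, ?_⟩
  have hz0 : ζ - z ≠ 0 := norm_pos_iff.1 hr0
  have hw0 : ζ - w ≠ 0 := norm_pos_iff.1 (by linarith)
  -- The difference of squares supplies the factor `z - w`; the constant `10` is `5 / 2` from the
  -- sum and `4` from comparing `‖ζ - w‖` with half of `‖ζ - z‖`.
  have e3 : ((ζ - z) ^ 2)⁻¹ - ((ζ - w) ^ 2)⁻¹
      = (z - w) * ((ζ - w) + (ζ - z)) * ((ζ - z) ^ 2)⁻¹ * ((ζ - w) ^ 2)⁻¹ := by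
    field_simp; ring
  rw [e3, norm_mul, norm_mul, norm_mul, norm_inv, norm_inv, norm_pow, norm_pow, ← hr]
  have t3 : ‖(ζ - w) + (ζ - z)‖ ≤ 5 / 2 * r := (norm_add_le _ _).trans (by rw [← hr]; linarith)
  have t4 : (‖ζ - w‖ ^ 2)⁻¹ ≤ ((r / 2) ^ 2)⁻¹ :=
    inv_anti₀ (by positivity) (pow_le_pow_left₀ (by positivity) hw 2)
  calc h₀ * ‖(ζ - w) + (ζ - z)‖ * (r ^ 2)⁻¹ * (‖ζ - w‖ ^ 2)⁻¹
      ≤ h₀ * (5 / 2 * r) * (r ^ 2)⁻¹ * ((r / 2) ^ 2)⁻¹ := by gcongr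
    _ = _ := by field_simp; ring

/-- The difference has two parts: the change of kernel, with a gain `η / r`, and the change of the
subtracted value `f z`. For the first, split at `r = √η`. Below, `log r` and `log η` are comparable
and the modulus of `f` at scale `r` suffices; above, `η / r ≤ √η` beats every power of the
logarithm. -/
lemma norm_regKernel_sub_le (hf : IsLogCont ν N Ω f) (hν : 1 < ν) {z w ζ : ℂ}
    (hz : z ∈ Ω) (hw : w ∈ Ω) (hζ : ζ ∈ Ω) (hzw : 0 < ‖z - w‖) (hs : ‖z - w‖ ≤ 1 / 9)
    (h : 2 * ‖z - w‖ ≤ ‖ζ - z‖) :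
    ‖regKernel f z ζ - regKernel f w ζ‖
      ≤ N * (5 * 2 ^ ν + 20 * (2 * ν) ^ ν + 4) * (-Real.log ‖z - w‖) ^ (-ν) * (‖ζ - z‖ ^ 2)⁻¹ := by
  obtain ⟨hw2, hk⟩ := norm_inv_sq_sub_inv_sq_le hzw h
  set η := ‖z - w‖ with hη
  set r := ‖ζ - z‖ with hr
  have hr0 : 0 < r := by linarith
  have hN := hf.nonneg
  set ℓ := -Real.log η with hℓ
  have hℓ0 : 0 < ℓ := neg_pos.2 (Real.log_neg hzw (by linarith))
  have hne : z ≠ ζ := by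
    rintro rfl; simp at hr; linarith
  have hsqrt : η ^ (1 / 2 : ℝ) ≤ (2 * ν) ^ ν * ℓ ^ (-ν) := by
    have := rpow_le_neg_log_rpow (β := 1 / 2) (μ := ν) (by norm_num) (by linarith) hzw (by linarith)
    rwa [show ν / (1 / 2) = 2 * ν by ring] at this
  have hηsq : η ^ (1 / 2 : ℝ) * η ^ (1 / 2 : ℝ) = η := by
    rw [← Real.rpow_add hzw]; norm_num
  have hηp : 0 < η ^ (1 / 2 : ℝ) := by positivity
  have hfirst : ‖f ζ - f z‖ * (η / r) ≤ N * (2 ^ ν / 2 + 2 * (2 * ν) ^ ν) * ℓ ^ (-ν) := by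
    rcases le_or_gt r (η ^ (1 / 2 : ℝ)) with hc | hc
    · have hr1 : r < 1 := hc.trans_lt (Real.rpow_lt_one hzw.le (by linarith) (by norm_num))
      have h1 := hf.modulus z hz ζ hζ hne (by rw [← hr]; exact hr1)
      rw [← hr] at h1
      have h2 : ℓ / 2 ≤ -Real.log r := by
        have := Real.log_le_log hr0 hc
        rw [Real.log_rpow hzw] at this
        rw [hℓ]; linarith
      have h3 : (-Real.log r) ^ (-ν) ≤ (ℓ / 2) ^ (-ν) :=
        Real.rpow_le_rpow_of_nonpos (by positivity) h2 (by linarith)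
      have h4 : (ℓ / 2) ^ (-ν) = 2 ^ ν * ℓ ^ (-ν) := by
        rw [Real.div_rpow hℓ0.le (by norm_num), Real.rpow_neg (x := 2) (by norm_num)]
        field_simp
      have h5 : η / r ≤ 1 / 2 := by rw [div_le_iff₀ hr0]; linarith
      rw [h4] at h3
      have h6 : 0 ≤ (2 * ν) ^ ν := by positivity
      calc ‖f ζ - f z‖ * (η / r) ≤ (N * (2 ^ ν * ℓ ^ (-ν))) * (1 / 2) :=
            mul_le_mul (h1.trans (mul_le_mul_of_nonneg_left h3 hN)) h5 (by positivity)
              (by positivity)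
        _ = N * (2 ^ ν / 2 + 0) * ℓ ^ (-ν) := by ring
        _ ≤ _ := by gcongr; positivity
    · have h1 : η / r ≤ η ^ (1 / 2 : ℝ) := by
        rw [div_le_iff₀ hr0]; nlinarith
      calc ‖f ζ - f z‖ * (η / r) ≤ (2 * N) * ((2 * ν) ^ ν * ℓ ^ (-ν)) :=
            mul_le_mul (hf.norm_sub_le hz hζ) (h1.trans hsqrt) (by positivity) (by positivity)
        _ = N * (0 + 2 * (2 * ν) ^ ν) * ℓ ^ (-ν) := by ring
        _ ≤ _ := by gcongr; positivity
  have hsecond : ‖f w - f z‖ ≤ N * ℓ ^ (-ν) := by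
    have := hf.modulus z hz w hw (by rintro rfl; simp [hη] at hzw)
      (by rw [norm_sub_rev, ← hη]; linarith)
    rwa [norm_sub_rev w z, ← hη] at this
  have hk2 : (‖ζ - w‖ ^ 2)⁻¹ ≤ 4 * (r ^ 2)⁻¹ := by
    have : (‖ζ - w‖ ^ 2)⁻¹ ≤ ((r / 2) ^ 2)⁻¹ :=
      inv_anti₀ (by positivity) (pow_le_pow_left₀ (by positivity) hw2 2)
    refine this.trans (le_of_eq ?_)
    field_simp; norm_num
  have e : regKernel f z ζ - regKernel f w ζ
      = (f ζ - f z) * (((ζ - z) ^ 2)⁻¹ - ((ζ - w) ^ 2)⁻¹) + (f w - f z) * ((ζ - w) ^ 2)⁻¹ := by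
    simp only [regKernel]; ring
  rw [e]
  refine (norm_add_le _ _).trans ?_
  rw [norm_mul, norm_mul, norm_inv ((ζ - w) ^ 2), norm_pow]
  calc _ ≤ ‖f ζ - f z‖ * (10 * (η / r) * (r ^ 2)⁻¹) + N * ℓ ^ (-ν) * (4 * (r ^ 2)⁻¹) := by gcongr
    _ = (10 * (‖f ζ - f z‖ * (η / r)) + 4 * (N * ℓ ^ (-ν))) * (r ^ 2)⁻¹ := by ring
    _ ≤ (10 * (N * (2 ^ ν / 2 + 2 * (2 * ν) ^ ν) * ℓ ^ (-ν)) + 4 * (N * ℓ ^ (-ν))) * (r ^ 2)⁻¹ := by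
        gcongr
    _ = _ := by ring

lemma norm_integral_regKernel_sub_le (hf : IsLogCont ν N Ω f) (hΩ : IsOpen Ω) (hν : 1 < ν) {R : ℝ}
    (hR1 : 1 ≤ R) (hR : Ω ⊆ ball 0 R) {z w : ℂ} (hz : z ∈ Ω) (hw : w ∈ Ω) (hzw : z ≠ w)
    (hs : ‖z - w‖ ≤ 1 / 9) :
    ‖(∫ ζ in Ω, regKernel f z ζ) - ∫ ζ in Ω, regKernel f w ζ‖ ≤
      (2 * (2 * Real.pi * (2 ^ (ν - 1) / (ν - 1)))
        + (5 * 2 ^ ν + 20 * (2 * ν) ^ ν + 4) * (2 * Real.pi * (Real.log (2 * R) + 1)))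
        * N * (-Real.log ‖z - w‖) ^ (1 - ν) := by
  set η := ‖z - w‖ with hη
  have hη0 : 0 < η := norm_pos_iff.2 (sub_ne_zero.2 hzw)
  set ℓ := -Real.log η with hℓ
  have hN := hf.nonneg
  have hℓ1 : 1 ≤ ℓ := one_le_neg_log hη0 hs
  have hℓ0 : 0 < ℓ := by linarith
  have hνm : 0 < ν - 1 := by linarith
  obtain ⟨iz, -⟩ := hf.regKernel_all hΩ hν hR1 hR hz
  obtain ⟨iw, -⟩ := hf.regKernel_all hΩ hν hR1 hR hw
  -- Stated for a general pole `x` so as to cover both `z` and `w`: the ball of radius `2 * η` about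
  -- `z` lies within `3 * η` of either. Since `3 * η ≤ √η`, enlarging the radius costs only a factor
  -- `2` in the logarithm.
  have hnear : ∀ x ∈ Ω, (Ω ∩ ball z (2 * η)) ⊆ Ω ∩ ball x (3 * η) →
      ‖∫ ζ in Ω ∩ ball z (2 * η), regKernel f x ζ‖
        ≤ N * (2 * Real.pi * (2 ^ (ν - 1) / (ν - 1))) * ℓ ^ (1 - ν) := by
    intro x hx hsub
    have h1 := (hf.regKernel_near hΩ hν hx (b := 3 * η) (by positivity) (by linarith)
      (hΩ.measurableSet.inter measurableSet_ball) hsub).2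
    have h2 : ℓ / 2 ≤ -Real.log (3 * η) := by
      have h3 : 3 * η ≤ η ^ (1 / 2 : ℝ) := by
        rw [← Real.sqrt_eq_rpow]
        refine Real.le_sqrt_of_sq_le ?_
        nlinarith
      have := Real.log_le_log (by positivity) h3
      rw [Real.log_rpow hη0] at this
      rw [hℓ]; linarith
    have h3 : (-Real.log (3 * η)) ^ (1 - ν) ≤ (ℓ / 2) ^ (1 - ν) :=
      Real.rpow_le_rpow_of_nonpos (by positivity) h2 (by linarith)
    have h4 : (ℓ / 2) ^ (1 - ν) = 2 ^ (ν - 1) * ℓ ^ (1 - ν) := by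
      rw [Real.div_rpow hℓ0.le (by norm_num), show (ν - 1) = -(1 - ν) by ring,
        Real.rpow_neg (x := 2) (by norm_num)]
      field_simp
    rw [h4] at h3
    refine h1.trans ?_
    calc _ ≤ N * (2 * Real.pi * ((2 ^ (ν - 1) * ℓ ^ (1 - ν)) / (ν - 1))) := by gcongr
      _ = _ := by ring
  have n1 := hnear z hz (inter_subset_inter_right _ (ball_subset_ball (by linarith)))
  have n2 := hnear w hw (inter_subset_inter_right _ fun ζ hζ => by
    rw [mem_ball, dist_eq_norm] at hζ ⊢
    have : ζ - w = (ζ - z) + (z - w) := by ring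
    rw [this]
    have := norm_add_le (ζ - z) (z - w)
    linarith)
  set G := Ω \ ball z (2 * η) with hG
  have hGsub : G ⊆ {ζ | ‖ζ - z‖ ∈ Ico (2 * η) (2 * R)} := fun ζ hζ =>
    ⟨by rw [← dist_eq_norm]; exact not_lt.1 hζ.2,
     by rw [← dist_eq_norm]; exact subset_ball_of_mem hR hz hζ.1⟩
  obtain ⟨ia, va⟩ := annulus_integral_sq (a := 2 * η) (b := 2 * R) (by positivity) (by linarith) z
  set C₁ := N * (5 * 2 ^ ν + 20 * (2 * ν) ^ ν + 4) * ℓ ^ (-ν) with hC₁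
  have hC₁0 : 0 ≤ C₁ := by positivity
  have n3 : ‖∫ ζ in G, (regKernel f z ζ - regKernel f w ζ)‖
      ≤ C₁ * (2 * Real.pi * (Real.log (2 * R) - Real.log (2 * η))) := by
    rw [← va, ← integral_const_mul]
    refine (norm_integral_le_of_norm_le ((ia.mono_set hGsub).const_mul C₁)
      ((ae_restrict_iff' (hΩ.measurableSet.diff measurableSet_ball)).2
        (Eventually.of_forall fun ζ hζ => ?_))).trans ?_
    · exact hf.norm_regKernel_sub_le hν hz hw hζ.1 hη0 hs (hGsub hζ).1
    · exact setIntegral_mono_set (ia.const_mul C₁)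
        (Eventually.of_forall fun ζ => by simp only [Pi.zero_apply]; positivity)
        (Eventually.of_forall hGsub)
  -- The annulus contributes one factor `ℓ`, turning the pointwise `ℓ ^ (-ν)` into `ℓ ^ (1 - ν)`.
  have n4 : C₁ * (2 * Real.pi * (Real.log (2 * R) - Real.log (2 * η))) ≤
      N * (5 * 2 ^ ν + 20 * (2 * ν) ^ ν + 4) * (2 * Real.pi * (Real.log (2 * R) + 1))
        * ℓ ^ (1 - ν) := by
    have h1 : Real.log (2 * R) - Real.log (2 * η) ≤ (Real.log (2 * R) + 1) * ℓ := by
      have h2 : 0 ≤ Real.log (2 * R) := Real.log_nonneg (by linarith)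
      have h3 : Real.log η ≤ Real.log (2 * η) := Real.log_le_log hη0 (by linarith)
      have h4 : -Real.log (2 * η) ≤ ℓ := by rw [hℓ]; linarith
      nlinarith
    have h5 : ℓ ^ (1 - ν) = ℓ * ℓ ^ (-ν) := by
      rw [show 1 - ν = 1 + -ν by ring, Real.rpow_add hℓ0, Real.rpow_one]
    rw [h5]
    calc _ ≤ C₁ * (2 * Real.pi * ((Real.log (2 * R) + 1) * ℓ)) := by gcongr
      _ = _ := by rw [hC₁]; ring
  rw [← integral_inter_add_sdiff (t := ball z (2 * η)) measurableSet_ball iz,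
    ← integral_inter_add_sdiff (t := ball z (2 * η)) measurableSet_ball iw]
  have e : ∀ a b c d : ℂ, a + b - (c + d) = (a - c) + (b - d) := fun a b c d => by ring
  rw [e, ← integral_sub (iz.mono_set sdiff_subset) (iw.mono_set sdiff_subset)]
  refine (norm_add_le _ _).trans ((add_le_add (_root_.norm_sub_le _ _) (n3.trans n4)).trans ?_)
  refine (add_le_add (add_le_add n1 n2) le_rfl).trans (le_of_eq ?_)
  ring

end IsLogCont

/-! ### Hölder continuity of the potential itself -/

lemma norm_inv_sub_inv_le_aux {x y : ℂ} (hx : x ≠ 0) (hxy : ‖x‖ ≤ ‖y‖) :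
    ‖x⁻¹ - y⁻¹‖ ≤ 2 * ‖x - y‖ ^ (1 / 2 : ℝ) * ‖x‖ ^ (-(3 / 2) : ℝ) := by
  have ha : 0 < ‖x‖ := norm_pos_iff.2 hx
  have hb : 0 < ‖y‖ := ha.trans_le hxy
  have hy : y ≠ 0 := norm_pos_iff.1 hb
  rw [inv_sub_inv hx hy, norm_div, norm_mul, norm_sub_rev]
  set h := ‖x - y‖ with hh
  have h0 : 0 ≤ h := norm_nonneg _
  -- Half of the power of `h` is traded for `‖y‖ ^ (1 / 2)`, which leaves the exponent `-3 / 2`,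
  -- integrable in the plane. The constant `4` is used, where `2` would do, for its exact square
  -- root.
  have h1 : h ≤ 4 * ‖y‖ := (norm_sub_le _ _).trans (by linarith)
  have h2 : h ^ (1 / 2 : ℝ) ≤ 2 * ‖y‖ ^ (1 / 2 : ℝ) := by
    have h3 := Real.rpow_le_rpow h0 h1 (show (0 : ℝ) ≤ 1 / 2 by norm_num)
    rw [Real.mul_rpow (by norm_num) hb.le] at h3
    have h4 : (4 : ℝ) ^ (1 / 2 : ℝ) = 2 := by
      rw [← Real.sqrt_eq_rpow, show (4 : ℝ) = 2 ^ 2 by norm_num, Real.sqrt_sq (by norm_num)]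
    rwa [h4] at h3
  have h3 : h = h ^ (1 / 2 : ℝ) * h ^ (1 / 2 : ℝ) := by
    rw [← Real.rpow_add_of_nonneg h0 (by norm_num) (by norm_num)]; norm_num
  have h4 : ‖y‖ ^ (1 / 2 : ℝ) / ‖y‖ ≤ ‖x‖ ^ (1 / 2 : ℝ) / ‖x‖ := by
    have e : ∀ t : ℝ, 0 < t → t ^ (1 / 2 : ℝ) / t = t ^ (-(1 / 2) : ℝ) := fun t ht => by
      rw [div_eq_iff ht.ne', ← Real.rpow_add_one ht.ne']; norm_num
    rw [e _ ha, e _ hb]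
    exact Real.rpow_le_rpow_of_nonpos ha hxy (by norm_num)
  have h5 : ‖x‖ ^ (-(3 / 2) : ℝ) = ‖x‖ ^ (1 / 2 : ℝ) / ‖x‖ / ‖x‖ := by
    rw [eq_div_iff ha.ne', eq_div_iff ha.ne', ← Real.rpow_add_one ha.ne', ← Real.rpow_add_one ha.ne']
    norm_num
  calc h / (‖x‖ * ‖y‖) = h ^ (1 / 2 : ℝ) * h ^ (1 / 2 : ℝ) / (‖x‖ * ‖y‖) := by rw [← h3]
    _ ≤ h ^ (1 / 2 : ℝ) * (2 * ‖y‖ ^ (1 / 2 : ℝ)) / (‖x‖ * ‖y‖) := by gcongr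
    _ = 2 * h ^ (1 / 2 : ℝ) * (‖y‖ ^ (1 / 2 : ℝ) / ‖y‖ / ‖x‖) := by field_simp
    _ ≤ 2 * h ^ (1 / 2 : ℝ) * (‖x‖ ^ (1 / 2 : ℝ) / ‖x‖ / ‖x‖) := by gcongr
    _ = _ := by rw [h5]

lemma norm_inv_sub_inv_le {x y : ℂ} (hx : x ≠ 0) (hy : y ≠ 0) :
    ‖x⁻¹ - y⁻¹‖ ≤
      2 * ‖x - y‖ ^ (1 / 2 : ℝ) * (‖x‖ ^ (-(3 / 2) : ℝ) + ‖y‖ ^ (-(3 / 2) : ℝ)) := by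
  rcases le_total ‖x‖ ‖y‖ with h | h
  · refine (norm_inv_sub_inv_le_aux hx h).trans ?_
    gcongr
    exact le_add_of_nonneg_right (by positivity)
  · rw [norm_sub_rev, norm_sub_rev x y]
    refine (norm_inv_sub_inv_le_aux hy h).trans ?_
    gcongr
    exact le_add_of_nonneg_left (by positivity)

lemma ae_restrict_ne (Ω : Set ℂ) (z : ℂ) : ∀ᵐ ζ ∂(volume.restrict Ω), ζ ≠ z :=
  ae_restrict_of_ae (compl_mem_ae_iff.2 (measure_singleton z))

namespace IsLogCont

variable {ν N : ℝ} {Ω : Set ℂ} {f : ℂ → ℂ}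

/-- Used to extend the potential to the closure. The direct estimate gives uniform continuity
without joining points by paths inside `Ω`. -/
lemma norm_solT_sub_le (hf : IsLogCont ν N Ω f) (hΩ : IsOpen Ω) {R : ℝ}
    (hR : Ω ⊆ ball 0 R) {z w : ℂ} (hz : z ∈ Ω) (hw : w ∈ Ω) :
    ‖solT Ω f z - solT Ω f w‖ ≤ 16 * (2 * R) ^ (1 / 2 : ℝ) * N * ‖z - w‖ ^ (1 / 2 : ℝ) := by
  have hbd : Bornology.IsBounded Ω := isBounded_ball.subset hR
  have hN := hf.nonneg
  have hR0 : 0 ≤ R := by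
    have h2 := mem_ball.1 (hR hz)
    linarith [dist_nonneg (x := z) (y := 0)]
  have hk : ∀ x ∈ Ω, IntegrableOn (fun ζ => ‖ζ - x‖ ^ (-(3 / 2) : ℝ)) Ω ∧
      ∫ ζ in Ω, ‖ζ - x‖ ^ (-(3 / 2) : ℝ) ≤ 4 * Real.pi * (2 * R) ^ (1 / 2 : ℝ) := by
    intro x hx
    obtain ⟨hi, hv⟩ := ball_integral_rpow (s := 3 / 2) (by norm_num) (by positivity : 0 ≤ 2 * R) x
    have hsub := subset_ball_of_mem hR hx
    refine ⟨hi.mono_set hsub, (setIntegral_mono_set hi (Eventually.of_forall fun ζ => by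
      simp only [Pi.zero_apply]; positivity) (Eventually.of_forall hsub)).trans (le_of_eq ?_)⟩
    rw [hv]
    norm_num
    ring
  obtain ⟨iz, vz⟩ := hk z hz
  obtain ⟨iw, vw⟩ := hk w hw
  rw [solT_eq, solT_eq, ← mul_sub, ← integral_sub (hf.integrableOn_mul_inv_sub hΩ hbd z)
    (hf.integrableOn_mul_inv_sub hΩ hbd w), norm_mul, norm_neg, norm_inv, Complex.norm_real,
    Real.norm_eq_abs, abs_of_pos Real.pi_pos]
  have h1 : ‖∫ ζ in Ω, (f ζ * (ζ - z)⁻¹ - f ζ * (ζ - w)⁻¹)‖ ≤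
      ∫ ζ in Ω, N * (2 * ‖z - w‖ ^ (1 / 2 : ℝ)) *
        (‖ζ - z‖ ^ (-(3 / 2) : ℝ) + ‖ζ - w‖ ^ (-(3 / 2) : ℝ)) := by
    refine norm_integral_le_of_norm_le ((iz.add iw).const_mul _) ?_
    filter_upwards [ae_restrict_mem hΩ.measurableSet, ae_restrict_ne Ω z, ae_restrict_ne Ω w]
      with ζ hζ hζz hζw
    rw [← mul_sub, norm_mul, mul_assoc]
    refine mul_le_mul (hf.bound ζ hζ) ?_ (norm_nonneg _) hN
    refine (norm_inv_sub_inv_le (sub_ne_zero.2 hζz) (sub_ne_zero.2 hζw)).trans (le_of_eq ?_)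
    rw [show ζ - z - (ζ - w) = -(z - w) by ring, norm_neg]
  rw [integral_const_mul, integral_add iz iw] at h1
  calc _ ≤ Real.pi⁻¹ * (N * (2 * ‖z - w‖ ^ (1 / 2 : ℝ)) * (4 * Real.pi * (2 * R) ^ (1 / 2 : ℝ)
          + 4 * Real.pi * (2 * R) ^ (1 / 2 : ℝ))) := by
        refine mul_le_mul_of_nonneg_left (h1.trans ?_) (by positivity)
        gcongr
    _ = _ := by field_simp; ring

/-! #### Differentiability of the potential -/

lemma integrableOn_sub_mul_inv_sub (hf : IsLogCont ν N Ω f) (hΩ : IsOpen Ω)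
    (hb : Bornology.IsBounded Ω) (z w : ℂ) :
    IntegrableOn (fun ζ => (f ζ - f z) * (ζ - w)⁻¹) Ω := by
  have h := (hf.integrableOn_mul_inv_sub hΩ hb w).sub ((integrableOn_inv_sub hb w).const_mul (f z))
  refine h.congr (Eventually.of_forall fun ζ => ?_)
  simp only [Pi.sub_apply]; ring

/-- The part of the difference quotient near the moving pole is small. -/
lemma norm_integral_near_pole_le (hΩ : IsOpen Ω) {z w : ℂ} (hzw : w ≠ z) {ε : ℝ} (hε : 0 ≤ ε)
    (hfε : ∀ ζ ∈ Ω, ‖ζ - z‖ ≤ 2 * ‖w - z‖ → ‖f ζ - f z‖ ≤ ε) :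
    ‖∫ ζ in Ω ∩ ball w (‖w - z‖ / 2), (f ζ - f z) * ((ζ - w)⁻¹ * (ζ - z)⁻¹)‖
      ≤ 2 * Real.pi * ε := by
  set η := ‖w - z‖ with hη
  have hη0 : 0 < η := norm_pos_iff.2 (sub_ne_zero.2 hzw)
  obtain ⟨hi, hv⟩ := ball_integral_rpow (s := 1) (by norm_num) (by positivity : 0 ≤ η / 2) w
  have hms : MeasurableSet (Ω ∩ ball w (η / 2)) := hΩ.measurableSet.inter measurableSet_ball
  have h1 : ‖∫ ζ in Ω ∩ ball w (η / 2), (f ζ - f z) * ((ζ - w)⁻¹ * (ζ - z)⁻¹)‖ ≤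
      ∫ ζ in Ω ∩ ball w (η / 2), ε * (2 / η) * ‖ζ - w‖ ^ (-1 : ℝ) := by
    refine norm_integral_le_of_norm_le ((hi.mono_set inter_subset_right).const_mul _) ?_
    refine (ae_restrict_iff' hms).2 (Eventually.of_forall fun ζ hζ => ?_)
    have hd := hζ.2
    rw [mem_ball, dist_eq_norm] at hd
    have t1 : ‖ζ - z‖ ≤ ‖ζ - w‖ + η := by
      rw [show ζ - z = (ζ - w) + (w - z) by ring]; exact norm_add_le _ _
    have t2 : η ≤ ‖ζ - w‖ + ‖ζ - z‖ := by
      rw [hη, show w - z = -(ζ - w) + (ζ - z) by ring]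
      exact (norm_add_le _ _).trans (by rw [norm_neg])
    have t3 : ‖ζ - z‖⁻¹ ≤ 2 / η := by
      rw [← inv_div]; exact inv_anti₀ (by positivity) (by linarith)
    rw [norm_mul, norm_mul, norm_inv, norm_inv, Real.rpow_neg_one]
    calc _ ≤ ε * (‖ζ - w‖⁻¹ * (2 / η)) := by
          refine mul_le_mul (hfε ζ hζ.1 (by linarith)) ?_ (by positivity) hε
          gcongr
      _ = _ := by ring
  refine h1.trans ?_
  rw [integral_const_mul]
  have h2 : ∫ ζ in Ω ∩ ball w (η / 2), ‖ζ - w‖ ^ (-1 : ℝ) ≤ 2 * Real.pi * (η / 2) := by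
    refine (setIntegral_mono_set hi (Eventually.of_forall fun ζ => by
      simp only [Pi.zero_apply]; positivity)
      (Eventually.of_forall inter_subset_right)).trans (le_of_eq ?_)
    rw [hv]; norm_num
  calc _ ≤ ε * (2 / η) * (2 * Real.pi * (η / 2)) := by gcongr
    _ = _ := by field_simp

/-- Off the ball around the moving pole one has `‖ζ - z‖ ≤ 3 * ‖ζ - w‖`, so three times the limiting
kernel dominates. The deleted ball shrinks to `z`, hence eventually misses each `ζ ≠ z`. -/
lemma tendsto_integral_off_pole (hf : IsLogCont ν N Ω f) (hΩ : IsOpen Ω) {z : ℂ}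
    (hi : IntegrableOn (regKernel f z) Ω) :
    Tendsto (fun w => ∫ ζ in Ω, (ball w (‖w - z‖ / 2))ᶜ.indicator
      (fun ζ => (f ζ - f z) * ((ζ - w)⁻¹ * (ζ - z)⁻¹)) ζ) (𝓝[≠] z)
      (𝓝 (∫ ζ in Ω, regKernel f z ζ)) := by
  refine tendsto_integral_filter_of_dominated_convergence (fun ζ => 3 * ‖regKernel f z ζ‖) ?_ ?_
    (hi.norm.const_mul 3) ?_
  · refine Eventually.of_forall fun w => AEStronglyMeasurable.indicator ?_ measurableSet_ball.compl
    refine ((hf.aestronglyMeasurable hΩ).sub aestronglyMeasurable_const).mul ?_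
    exact (by fun_prop : Measurable fun ζ : ℂ => (ζ - w)⁻¹ * (ζ - z)⁻¹).aestronglyMeasurable
  · filter_upwards [self_mem_nhdsWithin] with w hw
    have hη0 : 0 < ‖w - z‖ := norm_pos_iff.2 (sub_ne_zero.2 hw)
    filter_upwards [ae_restrict_ne Ω z] with ζ hζ
    by_cases hmem : ζ ∈ (ball w (‖w - z‖ / 2))ᶜ
    · rw [indicator_of_mem hmem, regKernel, norm_mul, norm_mul, norm_mul, norm_inv, norm_inv,
        norm_inv, norm_pow]
      rw [mem_compl_iff, mem_ball, dist_eq_norm, not_lt] at hmem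
      have hr : 0 < ‖ζ - z‖ := norm_pos_iff.2 (sub_ne_zero.2 hζ)
      have t1 : ‖ζ - z‖ ≤ ‖ζ - w‖ + ‖w - z‖ := by
        rw [show ζ - z = (ζ - w) + (w - z) by ring]; exact norm_add_le _ _
      have t2 : ‖ζ - w‖⁻¹ ≤ 3 * ‖ζ - z‖⁻¹ := by
        rw [← inv_inv (3 : ℝ), ← mul_inv]
        exact inv_anti₀ (by positivity) (by linarith)
      calc _ ≤ ‖f ζ - f z‖ * (3 * ‖ζ - z‖⁻¹ * ‖ζ - z‖⁻¹) := by gcongr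
        _ = _ := by rw [sq, mul_inv]; ring
    · rw [indicator_of_notMem hmem, norm_zero]; positivity
  · filter_upwards [ae_restrict_ne Ω z] with ζ hζ
    have hr : 0 < ‖ζ - z‖ := norm_pos_iff.2 (sub_ne_zero.2 hζ)
    have hev : ∀ᶠ w in 𝓝[≠] z, ζ ∈ (ball w (‖w - z‖ / 2))ᶜ := by
      filter_upwards [mem_nhdsWithin_of_mem_nhds (ball_mem_nhds z (half_pos hr))] with w hw
      rw [mem_ball, dist_eq_norm] at hw
      rw [mem_compl_iff, mem_ball, dist_eq_norm, not_lt]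
      have t1 : ‖ζ - z‖ ≤ ‖ζ - w‖ + ‖w - z‖ := by
        rw [show ζ - z = (ζ - w) + (w - z) by ring]; exact norm_add_le _ _
      linarith
    have hlim : Tendsto (fun w => (f ζ - f z) * ((ζ - w)⁻¹ * (ζ - z)⁻¹)) (𝓝[≠] z)
        (𝓝 (regKernel f z ζ)) := by
      have h1 : ContinuousAt (fun w => (f ζ - f z) * ((ζ - w)⁻¹ * (ζ - z)⁻¹)) z := by
        refine continuousAt_const.mul (ContinuousAt.mul ?_ continuousAt_const)
        exact (continuousAt_const.sub continuousAt_id).inv₀ (sub_ne_zero.2 hζ)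
      have h2 := h1.tendsto.mono_left (nhdsWithin_le_nhds (s := {z}ᶜ))
      simpa [regKernel, sq, mul_inv] using h2
    refine hlim.congr' ?_
    filter_upwards [hev] with w hw
    rw [indicator_of_mem hw]

/-- The difference quotient is split at the moving pole `w`: the ball around it contributes little
because `f` is continuous at `z`, and dominated convergence treats the rest. The subtracted constant
is tied to `z`, so differentiability is obtained at that point only. -/
lemma hasDerivAt_integral_sub (hf : IsLogCont ν N Ω f) (hΩ : IsOpen Ω)
    (hb : Bornology.IsBounded Ω) {z : ℂ} (hz : z ∈ Ω) (hi : IntegrableOn (regKernel f z) Ω) :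
    HasDerivAt (fun w => ∫ ζ in Ω, (f ζ - f z) * (ζ - w)⁻¹) (∫ ζ in Ω, regKernel f z ζ) z := by
  rw [hasDerivAt_iff_tendsto_slope]
  have hslope : ∀ w, w ≠ z → slope (fun w => ∫ ζ in Ω, (f ζ - f z) * (ζ - w)⁻¹) z w
      = ∫ ζ in Ω, (f ζ - f z) * ((ζ - w)⁻¹ * (ζ - z)⁻¹) := by
    intro w hw
    have hwz : w - z ≠ 0 := sub_ne_zero.2 hw
    rw [slope_def_field, ← integral_sub (hf.integrableOn_sub_mul_inv_sub hΩ hb z w)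
      (hf.integrableOn_sub_mul_inv_sub hΩ hb z z), ← integral_div]
    refine integral_congr_ae ?_
    filter_upwards [ae_restrict_ne Ω z, ae_restrict_ne Ω w] with ζ hζz hζw
    have h1 : ζ - z ≠ 0 := sub_ne_zero.2 hζz
    have h2 : ζ - w ≠ 0 := sub_ne_zero.2 hζw
    field_simp
    ring
  have hint : ∀ w, w ≠ z →
      IntegrableOn (fun ζ => (f ζ - f z) * ((ζ - w)⁻¹ * (ζ - z)⁻¹)) Ω := by
    intro w hw
    have hwz : w - z ≠ 0 := sub_ne_zero.2 hw
    refine (((hf.integrableOn_sub_mul_inv_sub hΩ hb z w).sub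
      (hf.integrableOn_sub_mul_inv_sub hΩ hb z z)).div_const (w - z)).congr ?_
    filter_upwards [ae_restrict_ne Ω z, ae_restrict_ne Ω w] with ζ hζz hζw
    have h1 : ζ - z ≠ 0 := sub_ne_zero.2 hζz
    have h2 : ζ - w ≠ 0 := sub_ne_zero.2 hζw
    simp only [Pi.sub_apply]
    field_simp
    ring
  have hnear : Tendsto (fun w => ∫ ζ in Ω ∩ ball w (‖w - z‖ / 2),
      (f ζ - f z) * ((ζ - w)⁻¹ * (ζ - z)⁻¹)) (𝓝[≠] z) (𝓝 0) := by
    rw [Metric.tendsto_nhds]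
    intro ε hε
    set ε' := ε / (2 * (2 * Real.pi)) with hε'
    have hε'0 : 0 < ε' := by positivity
    obtain ⟨δ, hδ, hfδ⟩ := Metric.continuousWithinAt_iff.1 (hf.continuousOn z hz) ε' hε'0
    filter_upwards [self_mem_nhdsWithin,
      mem_nhdsWithin_of_mem_nhds (ball_mem_nhds z (half_pos hδ))] with w hw hwδ
    rw [mem_ball, dist_eq_norm] at hwδ
    rw [dist_zero_right]
    refine (norm_integral_near_pole_le hΩ hw hε'0.le fun ζ hζ hd => ?_).trans_lt ?_
    · rw [← dist_eq_norm]
      exact (hfδ hζ (by rw [dist_eq_norm]; linarith)).le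
    · rw [hε']
      have : 2 * Real.pi * (ε / (2 * (2 * Real.pi))) = ε / 2 := by field_simp
      rw [this]; linarith
  have hsum := (tendsto_integral_off_pole hf hΩ hi).add hnear
  rw [add_zero] at hsum
  refine hsum.congr' ?_
  filter_upwards [self_mem_nhdsWithin] with w hw
  rw [hslope w hw, setIntegral_indicator measurableSet_ball.compl, add_comm]
  exact integral_inter_add_sdiff measurableSet_ball (hint w hw)

/-- The complex derivative `∂u/∂z` of the potential `u = Tf`. -/
noncomputable def _root_.LogCont.solTDeriv (Ω : Set ℂ) (R : ℝ) (f : ℂ → ℂ) (z : ℂ) : ℂ :=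
  -(Real.pi : ℂ)⁻¹ * (∫ ζ in Ω, regKernel f z ζ) + f z * beurling Ω R z

/-- With the density frozen at `z`, the regularized part contributes a complex linear derivative;
the conjugate linear part comes solely from the potential of the constant `f z`. -/
lemma hasFDerivAt_solT (hf : IsLogCont ν N Ω f) (hΩ : IsOpen Ω) (hν : 1 < ν) {R : ℝ} (hR1 : 1 ≤ R)
    (hR : Ω ⊆ ball 0 R) {z : ℂ} (hz : z ∈ Ω) :
    HasFDerivAt (solT Ω f) (solTDeriv Ω R f z • (1 : ℂ →L[ℝ] ℂ)
      + f z • (Complex.conjCLE : ℂ →L[ℝ] ℂ)) z := by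
  have hb : Bornology.IsBounded Ω := isBounded_ball.subset hR
  have hi := (hf.regKernel_all hΩ hν hR1 hR hz).1
  have h1 := (((hf.hasDerivAt_integral_sub hΩ hb hz hi).const_mul
    (-(Real.pi : ℂ)⁻¹)).hasFDerivAt.restrictScalars ℝ)
  have h2 := (hasFDerivAt_solT_one hΩ hR hz).const_mul (f z)
  have heq : solT Ω f = fun w => -(Real.pi : ℂ)⁻¹ * (∫ ζ in Ω, (f ζ - f z) * (ζ - w)⁻¹)
      + f z * solT Ω (fun _ => 1) w := by
    ext w
    have h3 : ∫ ζ in Ω, (f ζ - f z) * (ζ - w)⁻¹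
        = (∫ ζ in Ω, f ζ * (ζ - w)⁻¹) - f z * ∫ ζ in Ω, (ζ - w)⁻¹ := by
      rw [← integral_const_mul, ← integral_sub (hf.integrableOn_mul_inv_sub hΩ hb w)
        ((integrableOn_inv_sub hb w).const_mul (f z))]
      congr 1
      ext ζ
      ring
    rw [h3, solT_eq, solT_eq]
    simp only [one_mul]
    ring
  rw [heq]
  refine (h1.add h2).congr_fderiv ?_
  ext v
  simp [solTDeriv]
  ring

end IsLogCont

/-! ### The operator on log-continuous functions -/

lemma tendsto_neg_log_rpow {μ : ℝ} (hμ : μ < 0) :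
    Tendsto (fun h : ℝ => (-Real.log h) ^ μ) (𝓝[>] 0) (𝓝 0) := by
  have := tendsto_rpow_neg_atTop (neg_pos.2 hμ)
  rw [neg_neg] at this
  exact this.comp (tendsto_neg_atBot_atTop.comp Real.tendsto_log_nhdsGT_zero)

lemma uniformContinuousOn_of_modulus {Ω : Set ℂ} {g : ℂ → ℂ} {θ : ℝ → ℝ}
    (hθ : Tendsto θ (𝓝[>] 0) (𝓝 0))
    (h : ∀ z ∈ Ω, ∀ w ∈ Ω, z ≠ w → ‖z - w‖ ≤ 1 / 9 → ‖g z - g w‖ ≤ θ ‖z - w‖) :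
    UniformContinuousOn g Ω := by
  rw [Metric.uniformContinuousOn_iff]
  intro ε hε
  have h1 : ∀ᶠ t in 𝓝[>] (0 : ℝ), θ t < ε := hθ.eventually (gt_mem_nhds hε)
  obtain ⟨δ, hδ, hδ'⟩ := mem_nhdsGT_iff_exists_Ioo_subset.1 h1
  refine ⟨min δ (1 / 9), lt_min hδ (by norm_num), fun z hz w hw hzw => ?_⟩
  rcases eq_or_ne z w with rfl | hne
  · simpa using hε
  rw [dist_eq_norm] at hzw ⊢
  have h2 : 0 < ‖z - w‖ := norm_pos_iff.2 (sub_ne_zero.2 hne)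
  exact (h z hz w hw hne (hzw.trans_le (min_le_right _ _)).le).trans_lt
    (hδ' ⟨h2, hzw.trans_le (min_le_left _ _)⟩)

lemma exists_continuousOn_closure {Ω : Set ℂ} {g : ℂ → ℂ} (hg : UniformContinuousOn g Ω) :
    ∃ G : ℂ → ℂ, ContinuousOn G (closure Ω) ∧ EqOn G g Ω := by
  refine ⟨extendFrom Ω g, continuousOn_extendFrom subset_rfl fun x hx => ?_, fun x hx => ?_⟩
  · have hne : (𝓝[Ω] x).NeBot := mem_closure_iff_nhdsWithin_neBot.1 hx
    have hc : Cauchy (𝓝[Ω] x) := cauchy_nhds.mono nhdsWithin_le_nhds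
    have := hc.map_of_le hg inf_le_right
    exact CompleteSpace.complete this
  · exact extendFrom_eq (subset_closure hx) (hg.continuousOn x hx)

lemma le_logNorm_zero_of_mem {ν : ℝ} {Ω : Set ℂ} {f : ℂ → ℂ} {w w' : ℂ} (hw : w ∈ Ω)
    (hw' : w' ∈ Ω) : ‖f w‖ₑ ≤ logNorm 0 ν Ω f ∧
      ‖f w' - f w‖ₑ * ENNReal.ofReal (|Real.log ‖w' - w‖| ^ ν) ≤ logNorm 0 ν Ω f := by
  have hanti : Finset.HasAntidiagonal.antidiagonal 0 = {((0 : ℕ), (0 : ℕ))} := rfl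
  simp only [logNorm, zero_add, Finset.range_one, Finset.sum_singleton, hanti, multiDeriv,
    Function.iterate_zero, id]
  constructor
  · exact (le_iSup₂ (f := fun w (_ : w ∈ Ω) => ‖f w‖ₑ) w hw).trans le_self_add
  · refine le_trans ?_ le_add_self
    refine le_trans ?_ (le_iSup₂ (f := fun w (_ : w ∈ Ω) => ⨆ w' ∈ Ω,
      ‖f w' - f w‖ₑ * ENNReal.ofReal (|Real.log ‖w' - w‖| ^ ν)) w hw)
    exact le_iSup₂ (f := fun w' (_ : w' ∈ Ω) =>
      ‖f w' - f w‖ₑ * ENNReal.ofReal (|Real.log ‖w' - w‖| ^ ν)) w' hw'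

/-- Only distances below `1` are kept, where `|log|` is `-log` and the weight can be divided out; at
distance `1` the weight vanishes and carries no information. -/
lemma MemLog.isLogCont {ν : ℝ} {Ω : Set ℂ} {f : ℂ → ℂ} (hf : MemLog 0 ν Ω f) :
    IsLogCont ν (logNorm 0 ν Ω f).toReal Ω f where
  nonneg := ENNReal.toReal_nonneg
  continuousOn := hf.1.continuousOn
  bound z hz := by
    have := ENNReal.toReal_mono hf.2.ne (le_logNorm_zero_of_mem (ν := ν) (f := f) hz hz).1
    rwa [toReal_enorm] at this
  modulus z hz w hw hne h1 := by
    have := ENNReal.toReal_mono hf.2.ne (le_logNorm_zero_of_mem (ν := ν) (f := f) hz hw).2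
    have h0 : 0 < ‖w - z‖ := norm_pos_iff.2 (sub_ne_zero.2 hne.symm)
    have hl : Real.log ‖w - z‖ < 0 := Real.log_neg h0 h1
    have hl' : 0 < -Real.log ‖w - z‖ := by linarith
    rw [abs_of_neg hl, ENNReal.toReal_mul, toReal_enorm, ENNReal.toReal_ofReal (by positivity)]
      at this
    rw [Real.rpow_neg hl'.le, ← div_eq_mul_inv, le_div_iff₀ (by positivity)]
    exact this

lemma logNorm_one_le {μ M : ℝ} (hM : 0 ≤ M) {Ω : Set ℂ} {u : ℂ → ℂ} (h0 : ∀ w ∈ Ω, ‖u w‖ ≤ M)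
    (hx : ∀ w ∈ Ω, ‖partialX u w‖ ≤ M) (hy : ∀ w ∈ Ω, ‖partialY u w‖ ≤ M)
    (dx : ∀ w ∈ Ω, ∀ w' ∈ Ω, ‖partialX u w' - partialX u w‖ * |Real.log ‖w' - w‖| ^ μ ≤ M)
    (dy : ∀ w ∈ Ω, ∀ w' ∈ Ω, ‖partialY u w' - partialY u w‖ * |Real.log ‖w' - w‖| ^ μ ≤ M) :
    logNorm 1 μ Ω u ≤ ENNReal.ofReal (5 * M) := by
  have e : ∀ {g : ℂ → ℂ}, (∀ w ∈ Ω, ‖g w‖ ≤ M) → ⨆ w ∈ Ω, ‖g w‖ₑ ≤ ENNReal.ofReal M := by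
    intro g hg
    refine iSup₂_le fun w hw => ?_
    rw [← ofReal_norm]
    exact ENNReal.ofReal_le_ofReal (hg w hw)
  have d : ∀ {g : ℂ → ℂ},
      (∀ w ∈ Ω, ∀ w' ∈ Ω, ‖g w' - g w‖ * |Real.log ‖w' - w‖| ^ μ ≤ M) →
      ⨆ w ∈ Ω, ⨆ w' ∈ Ω, ‖g w' - g w‖ₑ * ENNReal.ofReal (|Real.log ‖w' - w‖| ^ μ)
        ≤ ENNReal.ofReal M := by
    intro g hg
    refine iSup₂_le fun w hw => iSup₂_le fun w' hw' => ?_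
    rw [← ofReal_norm, ← ENNReal.ofReal_mul (norm_nonneg _)]
    exact ENNReal.ofReal_le_ofReal (hg w hw w' hw')
  have hanti₀ : Finset.HasAntidiagonal.antidiagonal 0 = {((0 : ℕ), (0 : ℕ))} := rfl
  have hanti : Finset.HasAntidiagonal.antidiagonal 1 = {((0 : ℕ), (1 : ℕ)), (1, 0)} := rfl
  -- Five suprema: the function, its two partial derivatives, and the two weighted differences.
  have hsum : ENNReal.ofReal (5 * M) = ENNReal.ofReal M + (ENNReal.ofReal M + ENNReal.ofReal M)
      + (ENNReal.ofReal M + ENNReal.ofReal M) := by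
    rw [← ENNReal.ofReal_add hM hM, ← ENNReal.ofReal_add hM (by positivity),
      ← ENNReal.ofReal_add (by positivity) (by positivity)]
    congr 1; ring
  rw [logNorm, hsum]
  simp only [Nat.reduceAdd, Finset.sum_range_succ, Finset.sum_range_zero, zero_add,
    hanti₀, Finset.sum_singleton, hanti]
  rw [Finset.sum_pair (by simp), Finset.sum_pair (by simp)]
  exact add_le_add (add_le_add (e h0) (add_le_add (e hy) (e hx))) (add_le_add (d dy) (d dx))

/-- A bounded function with logarithmic modulus of continuity at small scales has it globally. -/
lemma weighted_difference_le {μ : ℝ} (hμ : 0 < μ) {R C : ℝ} (hR1 : 1 ≤ R) (hC : 0 ≤ C) {Ω : Set ℂ}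
    (hR : Ω ⊆ ball 0 R) {g : ℂ → ℂ} (hb : ∀ z ∈ Ω, ‖g z‖ ≤ C)
    (hg : ∀ z ∈ Ω, ∀ w ∈ Ω, z ≠ w → ‖z - w‖ ≤ 1 / 9 →
      ‖g z - g w‖ ≤ C * (-Real.log ‖z - w‖) ^ (-μ)) {z w : ℂ} (hz : z ∈ Ω) (hw : w ∈ Ω) :
    ‖g z - g w‖ * |Real.log ‖z - w‖| ^ μ
      ≤ (1 + 2 * (Real.log 9 + Real.log (2 * R)) ^ μ) * C := by
  have hlog : 0 ≤ Real.log (2 * R) := Real.log_nonneg (by linarith)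
  have hlog9 : 0 ≤ Real.log 9 := Real.log_nonneg (by norm_num)
  rcases eq_or_ne z w with rfl | hne
  · simp only [sub_self, norm_zero, zero_mul]; positivity
  have h0 : 0 < ‖z - w‖ := norm_pos_iff.2 (sub_ne_zero.2 hne)
  by_cases hs : ‖z - w‖ ≤ 1 / 9
  · have hl := one_le_neg_log h0 hs
    have hl0 : 0 < -Real.log ‖z - w‖ := by linarith
    rw [abs_of_neg (by linarith)]
    calc _ ≤ C * (-Real.log ‖z - w‖) ^ (-μ) * (-Real.log ‖z - w‖) ^ μ :=
          mul_le_mul_of_nonneg_right (hg z hz w hw hne hs) (by positivity)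
      _ = C := by rw [mul_assoc, ← Real.rpow_add hl0]; simp
      _ ≤ _ := by
        have : 0 ≤ (Real.log 9 + Real.log (2 * R)) ^ μ := by positivity
        nlinarith
  · have h1 : ‖z - w‖ < 2 * R := by
      have := IsLogCont.subset_ball_of_mem hR hw hz
      rwa [mem_ball, dist_eq_norm] at this
    -- At distances between `1 / 9` and `2 * R` the weight is bounded, so the sup bound on `g`
    -- suffices.
    have h2 : |Real.log ‖z - w‖| ≤ Real.log 9 + Real.log (2 * R) := by
      have h3 := Real.log_le_log h0 h1.le
      have h4 := Real.log_le_log (by norm_num) (not_le.1 hs).le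
      rw [one_div, Real.log_inv] at h4
      rw [abs_le]; constructor <;> linarith
    have h3 : ‖g z - g w‖ ≤ 2 * C := (norm_sub_le _ _).trans (by linarith [hb z hz, hb w hw])
    calc _ ≤ 2 * C * (Real.log 9 + Real.log (2 * R)) ^ μ :=
          mul_le_mul h3 (Real.rpow_le_rpow (abs_nonneg _) h2 hμ.le) (by positivity) (by positivity)
      _ ≤ _ := by nlinarith

lemma IsLogCont.modulus_sub_one {ν N : ℝ} {Ω : Set ℂ} {f : ℂ → ℂ} (hf : IsLogCont ν N Ω f)
    {z w : ℂ} (hz : z ∈ Ω) (hw : w ∈ Ω) (hne : z ≠ w) (hs : ‖z - w‖ ≤ 1 / 9) :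
    ‖f z - f w‖ ≤ N * (-Real.log ‖z - w‖) ^ (1 - ν) := by
  have h0 : 0 < ‖z - w‖ := norm_pos_iff.2 (sub_ne_zero.2 hne)
  refine (hf.modulus w hw z hz hne.symm (by linarith)).trans
    (mul_le_mul_of_nonneg_left ?_ hf.nonneg)
  exact Real.rpow_le_rpow_of_exponent_le (one_le_neg_log h0 hs) (by linarith)

lemma exists_solTDeriv_bound {Ω : Set ℂ} (hΩ : IsOpen Ω) {R : ℝ} (hR1 : 1 ≤ R)
    (hR : closure Ω ⊆ ball 0 R) {α : ℝ} (hα : 0 < α) (hb : HasC1HolderBoundary α Ω) {ν : ℝ}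
    (hν : 1 < ν) : ∃ C : ℝ, 0 ≤ C ∧ ∀ N f, IsLogCont ν N Ω f →
      (∀ z ∈ Ω, ‖solTDeriv Ω R f z‖ ≤ C * N) ∧
      ∀ z ∈ Ω, ∀ w ∈ Ω, z ≠ w → ‖z - w‖ ≤ 1 / 9 →
        ‖solTDeriv Ω R f z - solTDeriv Ω R f w‖ ≤ C * N * (-Real.log ‖z - w‖) ^ (1 - ν) := by
  obtain ⟨β, M, hβ, hM, hMb, hMh⟩ := exists_holder_beurling hΩ hR hα hb
  have hRΩ : Ω ⊆ ball 0 R := subset_closure.trans hR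
  obtain ⟨C₁, hC₁⟩ : ∃ C₁, C₁ = 2 * Real.pi * ((-Real.log (1 / 2)) ^ (1 - ν) / (ν - 1))
        + 2 * (2 * Real.pi * (Real.log (2 * R) - Real.log (1 / 2))) := ⟨_, rfl⟩
  obtain ⟨C₂, hC₂⟩ : ∃ C₂, C₂ = 2 * (2 * Real.pi * (2 ^ (ν - 1) / (ν - 1)))
        + (5 * 2 ^ ν + 20 * (2 * ν) ^ ν + 4) * (2 * Real.pi * (Real.log (2 * R) + 1)) := ⟨_, rfl⟩
  have hpi : ‖-(Real.pi : ℂ)⁻¹‖ = Real.pi⁻¹ := by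
    rw [norm_neg, norm_inv, Complex.norm_real, Real.norm_eq_abs, abs_of_pos Real.pi_pos]
  -- The cost of converting the Hölder modulus of `beurling` into the logarithmic modulus of
  -- exponent `ν - 1`.
  set c := ((ν - 1) / β) ^ (ν - 1) with hc
  have hν1 : 0 < ν - 1 := by linarith
  have hc0 : 0 ≤ c := by positivity
  refine ⟨Real.pi⁻¹ * |C₁| + Real.pi⁻¹ * |C₂| + M * c + M, by positivity, fun N f hf => ⟨?_, ?_⟩⟩
  · intro z hz
    have hN := hf.nonneg
    have h1 := (hf.regKernel_all hΩ hν hR1 hRΩ hz).2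
    rw [← hC₁] at h1
    rw [solTDeriv]
    refine (norm_add_le _ _).trans ?_
    rw [norm_mul, norm_mul, hpi]
    have h2 : C₁ * N ≤ |C₁| * N := mul_le_mul_of_nonneg_right (le_abs_self _) hN
    calc _ ≤ Real.pi⁻¹ * (|C₁| * N) + N * M := by
          refine add_le_add (mul_le_mul_of_nonneg_left (h1.trans h2) (by positivity)) ?_
          exact mul_le_mul (hf.bound z hz) (hMb z hz) (norm_nonneg _) hN
      _ = (Real.pi⁻¹ * |C₁| + 0 + 0 + M) * N := by ring
      _ ≤ _ := by gcongr <;> positivity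
  · intro z hz w hw hne hs
    have hN := hf.nonneg
    have h0 : 0 < ‖z - w‖ := norm_pos_iff.2 (sub_ne_zero.2 hne)
    have hl : 0 < -Real.log ‖z - w‖ := by linarith [one_le_neg_log h0 hs]
    set ℓ := (-Real.log ‖z - w‖) ^ (1 - ν) with hℓ
    have hℓ0 : 0 ≤ ℓ := by positivity
    have h1 := hf.norm_integral_regKernel_sub_le hΩ hν hR1 hRΩ hz hw hne hs
    rw [← hC₂, ← hℓ] at h1
    have h2 : C₂ * N * ℓ ≤ |C₂| * N * ℓ := by gcongr; exact le_abs_self _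
    have h3 : ‖beurling Ω R z - beurling Ω R w‖ ≤ M * (c * ℓ) := by
      refine (hMh z hz w hw).trans (mul_le_mul_of_nonneg_left ?_ hM)
      have := rpow_le_neg_log_rpow hβ hν1 h0 (by linarith)
      rwa [neg_sub] at this
    have h4 := hf.modulus_sub_one hz hw hne hs
    rw [← hℓ] at h4
    -- The product `f * beurling` is differenced by the product rule; the factor `f` already has the
    -- better exponent `ν`, weakened by `modulus_sub_one`.
    have e : solTDeriv Ω R f z - solTDeriv Ω R f w
        = -(Real.pi : ℂ)⁻¹ * ((∫ ζ in Ω, regKernel f z ζ) - ∫ ζ in Ω, regKernel f w ζ)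
          + f z * (beurling Ω R z - beurling Ω R w) + (f z - f w) * beurling Ω R w := by
      simp only [solTDeriv]; ring
    rw [e]
    refine (norm_add_le _ _).trans ((add_le_add (norm_add_le _ _) le_rfl).trans ?_)
    rw [norm_mul, norm_mul, norm_mul, hpi]
    calc _ ≤ Real.pi⁻¹ * (|C₂| * N * ℓ) + N * (M * (c * ℓ)) + N * ℓ * M := by
          refine add_le_add (add_le_add (mul_le_mul_of_nonneg_left (h1.trans h2) (by positivity)) ?_)
            ?_
          · exact mul_le_mul (hf.bound z hz) h3 (norm_nonneg _) hN
          · exact mul_le_mul h4 (hMb w hw) (norm_nonneg _) (by positivity)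
      _ = (0 + Real.pi⁻¹ * |C₂| + M * c + M) * N * ℓ := by ring
      _ ≤ _ := by gcongr; positivity

/-! ### First derivatives of the potential and the equation -/

section

variable {ν N R : ℝ} {Ω : Set ℂ} {f : ℂ → ℂ}

lemma IsLogCont.partialX_solT (hf : IsLogCont ν N Ω f) (hΩ : IsOpen Ω) (hν : 1 < ν) (hR1 : 1 ≤ R)
    (hR : Ω ⊆ ball 0 R) {z : ℂ} (hz : z ∈ Ω) :
    partialX (solT Ω f) z = solTDeriv Ω R f z + f z := by
  rw [partialX, (hf.hasFDerivAt_solT hΩ hν hR1 hR hz).fderiv]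
  simp

lemma IsLogCont.partialY_solT (hf : IsLogCont ν N Ω f) (hΩ : IsOpen Ω) (hν : 1 < ν) (hR1 : 1 ≤ R)
    (hR : Ω ⊆ ball 0 R) {z : ℂ} (hz : z ∈ Ω) :
    partialY (solT Ω f) z = Complex.I * (solTDeriv Ω R f z - f z) := by
  rw [partialY, (hf.hasFDerivAt_solT hΩ hν hR1 hR hz).fderiv]
  simp
  ring

lemma IsLogCont.dbar_solT (hf : IsLogCont ν N Ω f) (hΩ : IsOpen Ω) (hν : 1 < ν) (hR1 : 1 ≤ R)
    (hR : Ω ⊆ ball 0 R) {z : ℂ} (hz : z ∈ Ω) : dbar (solT Ω f) z = f z := by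
  rw [dbar, hf.partialX_solT hΩ hν hR1 hR hz, hf.partialY_solT hΩ hν hR1 hR hz, ← mul_assoc,
    Complex.I_mul_I]
  ring

lemma IsLogCont.contDiffOn_solT (hf : IsLogCont ν N Ω f) (hΩ : IsOpen Ω) (hν : 1 < ν) (hR1 : 1 ≤ R)
    (hR : Ω ⊆ ball 0 R) (hc : ContinuousOn (solTDeriv Ω R f) Ω) :
    ContDiffOn ℝ 1 (solT Ω f) Ω := by
  rw [show (1 : WithTop ℕ∞) = 0 + 1 by rfl, contDiffOn_succ_iff_fderiv_of_isOpen hΩ]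
  refine ⟨fun z hz =>
    (hf.hasFDerivAt_solT hΩ hν hR1 hR hz).differentiableAt.differentiableWithinAt, by simp, ?_⟩
  rw [contDiffOn_zero]
  refine ContinuousOn.congr (f := fun z => solTDeriv Ω R f z • (1 : ℂ →L[ℝ] ℂ)
      + f z • (Complex.conjCLE : ℂ →L[ℝ] ℂ)) ?_
    fun z hz => (hf.hasFDerivAt_solT hΩ hν hR1 hR hz).fderiv
  exact (hc.smul continuousOn_const).add (hf.continuousOn.smul continuousOn_const)

end

end LogCont

/-! ### Assembly: boundedness of the operator and regularity up to the boundary -/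

theorem mainTheorem3 (Ω : Set ℂ) (hopen : IsOpen Ω) (hconn : IsConnected Ω)
    (hbdd : Bornology.IsBounded Ω)
    (hbdry : ∃ α : ℝ, 0 < α ∧ LogCont.HasC1HolderBoundary α Ω)
    (ν : ℝ) (hν : 1 < ν) :
    -- the defining integral of `T` converges absolutely
    (∀ f : ℂ → ℂ, LogCont.MemLog 0 ν Ω f → ∀ z ∈ Ω,
      IntegrableOn (fun ζ => f ζ / (ζ - z)) Ω) ∧
    -- `T` is linear
    (∀ f g : ℂ → ℂ, LogCont.MemLog 0 ν Ω f → LogCont.MemLog 0 ν Ω g → ∀ a b : ℂ, ∀ z ∈ Ω,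
      LogCont.solT Ω (fun ζ => a * f ζ + b * g ζ) z
        = a * LogCont.solT Ω f z + b * LogCont.solT Ω g z) ∧
    -- `T` maps the first space into the second and is bounded
    (∃ C : NNReal, ∀ f : ℂ → ℂ, LogCont.MemLog 0 ν Ω f →
      LogCont.MemLog 1 (ν - 1) Ω (LogCont.solT Ω f) ∧
      LogCont.logNorm 1 (ν - 1) Ω (LogCont.solT Ω f) ≤ C * LogCont.logNorm 0 ν Ω f) ∧
    -- `Tf` is a classical solution
    (∀ f : ℂ → ℂ, LogCont.MemLog 0 ν Ω f →
      LogCont.MemCkClosure 1 Ω (LogCont.solT Ω f) ∧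
      ∀ z ∈ Ω, LogCont.dbar (LogCont.solT Ω f) z = f z) := by
  open LogCont Set Filter Topology Metric in
  obtain ⟨α, hα, hb⟩ := hbdry
  obtain ⟨R₀, hR₀⟩ := hbdd.closure.subset_ball (0 : ℂ)
  -- Requiring `R ≥ 1` makes `log (2 * R)` nonnegative and keeps the cut-off radii `1 / 2` and `2 *
  -- η` below `2 * R`.
  set R := max R₀ 1 with hR_def
  have hR1 : 1 ≤ R := le_max_right _ _
  have hRc : closure Ω ⊆ ball 0 R := hR₀.trans (ball_subset_ball (le_max_left _ _))
  have hR : Ω ⊆ ball 0 R := subset_closure.trans hRc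
  have hν1 : 0 < ν - 1 := by linarith
  obtain ⟨C, hC, hCb⟩ := exists_solTDeriv_bound hopen hR1 hRc hα hb hν
  have hcd : ∀ f, MemLog 0 ν Ω f → UniformContinuousOn (solTDeriv Ω R f) Ω := fun f hf => by
    have hlim := (tendsto_neg_log_rpow (μ := 1 - ν) (by linarith)).const_mul
      (C * (logNorm 0 ν Ω f).toReal)
    rw [mul_zero] at hlim
    exact uniformContinuousOn_of_modulus hlim (hCb _ f hf.isLogCont).2
  have hcf : ∀ f, MemLog 0 ν Ω f → UniformContinuousOn f Ω := fun f hf => by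
    have hlim := (tendsto_neg_log_rpow (μ := 1 - ν) (by linarith)).const_mul
      (logNorm 0 ν Ω f).toReal
    rw [mul_zero] at hlim
    exact uniformContinuousOn_of_modulus hlim fun z hz w hw hne hs =>
      hf.isLogCont.modulus_sub_one hz hw hne hs
  have hC1 : ∀ f, MemLog 0 ν Ω f → ContDiffOn ℝ 1 (solT Ω f) Ω := fun f hf =>
    hf.isLogCont.contDiffOn_solT hopen hν hR1 hR (hcd f hf).continuousOn
  refine ⟨fun f hf z _ => ?_, fun f g hf hg a b z _ => ?_, ?_, fun f hf => ⟨⟨hC1 f hf, ?_⟩, ?_⟩⟩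
  · simp only [div_eq_mul_inv]
    exact hf.isLogCont.integrableOn_mul_inv_sub hopen hbdd z
  · have h1 := hf.isLogCont.integrableOn_mul_inv_sub hopen hbdd z
    have h2 := hg.isLogCont.integrableOn_mul_inv_sub hopen hbdd z
    simp only [solT_eq]
    have e : ∫ ζ in Ω, (a * f ζ + b * g ζ) * (ζ - z)⁻¹
        = a * (∫ ζ in Ω, f ζ * (ζ - z)⁻¹) + b * ∫ ζ in Ω, g ζ * (ζ - z)⁻¹ := by
      rw [← integral_const_mul, ← integral_const_mul,
        ← integral_add (h1.const_mul a) (h2.const_mul b)]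
      congr 1
      ext ζ
      ring
    rw [e]; ring
  · set Λ := 1 + 2 * (Real.log 9 + Real.log (2 * R)) ^ (ν - 1) with hΛ
    have hΛ1 : 1 ≤ Λ := by
      have h1 : 0 ≤ Real.log 9 := Real.log_nonneg (by norm_num)
      have h2 : 0 ≤ Real.log (2 * R) := Real.log_nonneg (by linarith)
      have : 0 ≤ (Real.log 9 + Real.log (2 * R)) ^ (ν - 1) := by positivity
      linarith
    -- The term `4 * R` bounds the potential; `C + 1` bounds its partial derivatives, which combine
    -- `solTDeriv` and `f`; `Λ` accounts for distances above `1 / 9`.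
    set C' := 4 * R + Λ * (C + 1) with hC'
    have hC'0 : 0 ≤ C' := by positivity
    have hbound : ∀ f, MemLog 0 ν Ω f → logNorm 1 (ν - 1) Ω (solT Ω f)
        ≤ ((5 * C').toNNReal : ENNReal) * logNorm 0 ν Ω f := by
      intro f hf
      set N := (logNorm 0 ν Ω f).toReal with hN
      have hl : IsLogCont ν N Ω f := hf.isLogCont
      have hN0 : 0 ≤ N := hl.nonneg
      obtain ⟨b1, b2⟩ := hCb N f hl
      have hle : (C + 1) * N ≤ C' * N := by
        refine mul_le_mul_of_nonneg_right ?_ hN0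
        nlinarith
      have hle' : Λ * ((C + 1) * N) ≤ C' * N := by
        rw [← mul_assoc]
        exact mul_le_mul_of_nonneg_right (by linarith) hN0
      have X : ∀ z ∈ Ω, partialX (solT Ω f) z = solTDeriv Ω R f z + f z := fun z hz =>
        hl.partialX_solT hopen hν hR1 hR hz
      have Y : ∀ z ∈ Ω, partialY (solT Ω f) z = Complex.I * (solTDeriv Ω R f z - f z) :=
        fun z hz => hl.partialY_solT hopen hν hR1 hR hz
      have bX : ∀ z ∈ Ω, ‖partialX (solT Ω f) z‖ ≤ (C + 1) * N := fun z hz => by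
        rw [X z hz]
        exact (norm_add_le _ _).trans (by linarith [b1 z hz, hl.bound z hz])
      have bY : ∀ z ∈ Ω, ‖partialY (solT Ω f) z‖ ≤ (C + 1) * N := fun z hz => by
        rw [Y z hz, norm_mul, Complex.norm_I, one_mul]
        exact (norm_sub_le _ _).trans (by linarith [b1 z hz, hl.bound z hz])
      have mX : ∀ z ∈ Ω, ∀ w ∈ Ω, z ≠ w → ‖z - w‖ ≤ 1 / 9 →
          ‖partialX (solT Ω f) z - partialX (solT Ω f) w‖
            ≤ (C + 1) * N * (-Real.log ‖z - w‖) ^ (-(ν - 1)) := fun z hz w hw hne hs => by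
        rw [X z hz, X w hw, neg_sub, add_sub_add_comm]
        exact (norm_add_le _ _).trans
          (by linarith [b2 z hz w hw hne hs, hl.modulus_sub_one hz hw hne hs])
      have mY : ∀ z ∈ Ω, ∀ w ∈ Ω, z ≠ w → ‖z - w‖ ≤ 1 / 9 →
          ‖partialY (solT Ω f) z - partialY (solT Ω f) w‖
            ≤ (C + 1) * N * (-Real.log ‖z - w‖) ^ (-(ν - 1)) := fun z hz w hw hne hs => by
        rw [Y z hz, Y w hw, neg_sub, ← mul_sub, norm_mul, Complex.norm_I, one_mul, sub_sub_sub_comm]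
        exact (norm_sub_le _ _).trans
          (by linarith [b2 z hz w hw hne hs, hl.modulus_sub_one hz hw hne hs])
      have hCN : 0 ≤ (C + 1) * N := by positivity
      have key := logNorm_one_le (μ := ν - 1) (M := C' * N) (by positivity) (u := solT Ω f) (Ω := Ω)
        (fun z hz => (hl.norm_solT_le hopen hR hz).trans
          (mul_le_mul_of_nonneg_right (by nlinarith) hN0))
        (fun z hz => (bX z hz).trans hle) (fun z hz => (bY z hz).trans hle)
        (fun w hw w' hw' => (weighted_difference_le hν1 hR1 hCN hR bX mX hw' hw).trans hle')
        (fun w hw w' hw' => (weighted_difference_le hν1 hR1 hCN hR bY mY hw' hw).trans hle')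
      refine key.trans (le_of_eq ?_)
      rw [← mul_assoc, ENNReal.ofReal_mul (by positivity), hN, ENNReal.ofReal_toReal hf.2.ne]
      rfl
    exact ⟨(5 * C').toNNReal, fun f hf => ⟨⟨hC1 f hf,
      (hbound f hf).trans_lt (ENNReal.mul_lt_top ENNReal.coe_lt_top hf.2)⟩, hbound f hf⟩⟩
  · have hl := hf.isLogCont
    have hu : UniformContinuousOn (solT Ω f) Ω := by
      have hlim : Tendsto (fun t : ℝ => 16 * (2 * R) ^ (1 / 2 : ℝ) * (logNorm 0 ν Ω f).toReal
          * t ^ (1 / 2 : ℝ)) (𝓝[>] 0) (𝓝 0) := by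
        have h1 : Continuous fun t : ℝ => 16 * (2 * R) ^ (1 / 2 : ℝ) * (logNorm 0 ν Ω f).toReal
          * t ^ (1 / 2 : ℝ) := (Real.continuous_rpow_const (by norm_num)).const_mul _
        have h2 := (h1.tendsto 0).mono_left (nhdsWithin_le_nhds (s := Ioi 0))
        rwa [Real.zero_rpow (by norm_num), mul_zero] at h2
      exact uniformContinuousOn_of_modulus hlim fun z hz w hw _ _ =>
        hl.norm_solT_sub_le hopen hR hz hw
    -- Extending the potential, `solTDeriv` and `f` suffices, since both partial derivatives are
    -- linear combinations of the last two.
    obtain ⟨U, hU, hU'⟩ := exists_continuousOn_closure hu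
    obtain ⟨A, hA, hA'⟩ := exists_continuousOn_closure (hcd f hf)
    obtain ⟨F, hF, hF'⟩ := exists_continuousOn_closure (hcf f hf)
    rintro ⟨i, j⟩ hij
    have hcases : (i = 0 ∧ j = 0) ∨ (i = 1 ∧ j = 0) ∨ (i = 0 ∧ j = 1) := by
      simp only at hij; omega
    rcases hcases with ⟨rfl, rfl⟩ | ⟨rfl, rfl⟩ | ⟨rfl, rfl⟩
    · exact ⟨U, hU, hU'⟩
    · refine ⟨fun z => A z + F z, hA.add hF, fun z hz => ?_⟩
      change A z + F z = partialX (solT Ω f) z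
      rw [hA' hz, hF' hz, hl.partialX_solT hopen hν hR1 hR hz]
    · refine ⟨fun z => Complex.I * (A z - F z), continuousOn_const.mul (hA.sub hF), fun z hz => ?_⟩
      change Complex.I * (A z - F z) = partialY (solT Ω f) z
      rw [hA' hz, hF' hz, hl.partialY_solT hopen hν hR1 hR hz]
  · exact fun z hz => hf.isLogCont.dbar_solT hopen hν hR1 hR hz
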